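/- **Conventions.** Lattices are bounded distributive lattices, lattice homomorphisms preserve $0,1,\wedge,\vee$, and rings are commutative with $1$. For a universe level $\ell$, $\mathsf{CommRing}_\ell$ and $\mathsf{Set}_\ell$ are the categories of rings and sets in the $\ell$-th universe. *Supports and the Zariski lattice.* A support of a ring $R$ in a lattice $L$ is a map $d:R\to L$ with $d(0)=0$, $d(1)=1$, $d(fg)=d(f)\wedge d(g)$ and $d(f+g)\le d(f)\vee d(g)$. The Zariski lattice $\mathcal L_R$ is the lattice of radicals of finitely generated ideals of $R$, ordered by inclusion; $D(f)=\sqrt{(f)}$. A ring homomorphism $\varphi:R\to A$ induces the lattice homomorphism $\mathcal L_R\to\mathcal L_A$ with $D(f)\mapsto D(\varphi(f))$. *Locally ringed lattices.* A locally ringed lattice $X$ (of level $\ell$) consists of a lattice $L_X$, a sheaf of rings $\mathcal O_X$ on $L_X$ (a functor $L_X^{op}\to\mathsf{CommRing}_\ell$ such that, for all $n\ge 0$ and $x=u_1\vee\dots\vee u_n$, $\mathcal O_X(x)$ is the equalizer of $\prod_i\mathcal O_X(u_i)\rightrightarrows\prod_{i,j}\mathcal O_X(u_i\wedge u_j)$),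 and an invertibility support, i.e. for every $u\in L_X$ a map $\mathcal D_u:\mathcal O_X(u)\to{\downarrow}u$ that is a support and is such that, for all $s\in\mathcal O_X(u)$ and $v\le u$, one has $v\le\mathcal D_u(s)$ if and only if $s|_v$ is invertible. A morphism in $\mathsf{LRDL}_\ell$ from $X$ to $Y$ is a pair of a lattice homomorphism $\pi^*:L_X\to L_Y$ and a natural transformation $\pi^\sharp:\mathcal O_X\Rightarrow\mathcal O_Y\circ\pi^*$ with $\pi^*(\mathcal D_u(s))=\mathcal D_{\pi^*(u)}(\pi^\sharp(s))$ for all $u\in L_X$, $s\in\mathcal O_X(u)$. Passing to higher universes gives a functor $\mathsf{lift}:\mathsf{LRDL}_\ell^{op}\to\mathsf{LRDL}_{\ell+1}^{op}$. *Spectrum and functor of points.* For a ring $R$, $\mathsf{Spec}(R)=(\mathcal L_R,\mathcal O_R)$ with $\mathcal O_R(u)=\lim_{D(f)\le u}R_f$, so that $\mathcal O_R(D(f))=R_f$; the invertibility support is determined by $\mathcal D_{D(f)}(r/f^n)=D(fr)$. This is a functor $\mathsf{Spec}:\mathsf{CommRing}_\ell^{op}\to\mathsf{LRDL}_\ell^{op}$.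 The category $\mathbb Z\text{-}\mathsf{Fun}_\ell$ of $\mathbb Z$-functors is the category of functors $\mathsf{CommRing}_\ell\to\mathsf{Set}_\ell$ and natural transformations. The functor of points $h:\mathsf{LRDL}_\ell^{op}\to\mathbb Z\text{-}\mathsf{Fun}_\ell$ is $h_Y(R)=\mathrm{Hom}_{\mathsf{LRDL}_\ell^{op}}(\mathsf{Spec}(R),Y)$. *Geometric realization.* Let $\mathcal L$ be the $\mathbb Z$-functor $R\mapsto\mathcal L_R$ and let $\mathbb A^1$ be the $\mathbb Z$-functor sending $R$ to its underlying set. For a $\mathbb Z$-functor $X$, the natural transformations $U:X\Rightarrow\mathcal L$ (compact opens of $X$) form, pointwise, a lattice $\mathsf{CompOpen}(X)$. The realization of $U$ is the subfunctor $[\![U]\!]\subseteq X$ with $[\![U]\!](R)=\{x\in X(R)\mid U(x)=D(1)\}$. The geometric realization $|X|$ is the locally ringed lattice of level $\ell+1$ with lattice $\mathsf{CompOpen}(X)$ and sheaf $U\mapsto([\![U]\!]\Rightarrow\mathbb A^1)$, a ring with pointwise operations; its invertibility support sends $s:[\![U]\!]\Rightarrow\mathbb A^1$ to the compact open whose value at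 $x\in X(R)$ is the largest $v\le U(x)$ in $\mathcal L_R$ on which the section of $\mathcal O_R$ over $U(x)$ with components $s(x|_{R_f})\in R_f$ (for $D(f)\le U(x)$) is invertible. Precomposition makes this a functor $|\_|:\mathbb Z\text{-}\mathsf{Fun}_\ell\to\mathsf{LRDL}_{\ell+1}^{op}$. **Proposition.** Geometric realization is left adjoint to the functor of points relative to universe lifting, $|\_|\dashv_{\mathsf{lift}}h$. That is, for all $\mathbb Z$-functors $X:\mathbb Z\text{-}\mathsf{Fun}_\ell$ and all $Y:\mathsf{LRDL}_\ell^{op}$ there is a bijection $$\mathrm{Hom}_{\mathsf{LRDL}_{\ell+1}^{op}}\big(|X|,\mathsf{lift}(Y)\big)\;\cong\;\big(X\Rightarrow h_Y\big),$$ and these bijections are natural in $X$ and in $Y$. -/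

import Mathlib

open CategoryTheory Opposite

universe u

/-- A support on a ring `R` with values in a bounded lattice `L`. -/
structure IsSupport {R L : Type*} [CommRing R] [Lattice L] [BoundedOrder L] (d : R → L) :
    Prop where
  map_zero : d 0 = ⊥
  map_one : d 1 = ⊤
  map_mul : ∀ x y, d (x * y) = d x ⊓ d y
  map_add_le : ∀ x y, d (x + y) ≤ d x ⊔ d y

/-- The Zariski lattice of a commutative ring: the radicals of finitely generated ideals,
ordered by inclusion. -/
@[ext]
structure ZariskiLattice (R : Type u) [CommRing R] : Type u where
  ideal : Ideal R
  exists_fg : ∃ J : Ideal R, J.FG ∧ J.radical = ideal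

namespace ZariskiLattice

variable {R A B : Type u} [CommRing R] [CommRing A] [CommRing B]

/-- The radical of a finitely generated ideal as an element of the Zariski lattice. -/
def ofFG (J : Ideal R) (hJ : J.FG) : ZariskiLattice R := ⟨J.radical, J, hJ, rfl⟩

theorem isRadical (u : ZariskiLattice R) : u.ideal.IsRadical := by
  obtain ⟨_, J, _, rfl⟩ := u
  exact J.radical_isRadical

instance : PartialOrder (ZariskiLattice R) := PartialOrder.lift ideal fun _ _ => ZariskiLattice.ext

theorem le_iff {u v : ZariskiLattice R} : u ≤ v ↔ u.ideal ≤ v.ideal := Iff.rfl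

theorem fg_sup {I J : Ideal R} (hI : I.FG) (hJ : J.FG) : (I ⊔ J).FG := by
  classical
  obtain ⟨s, rfl⟩ := hI
  obtain ⟨t, rfl⟩ := hJ
  exact ⟨s ∪ t, by rw [Finset.coe_union, Ideal.span_union]⟩

theorem radical_sup_inf_le (I J K : Ideal R) :
    (I ⊔ J).radical ⊓ (I ⊔ K).radical ≤ (I ⊔ (J ⊓ K)).radical := by
  rw [← Ideal.radical_mul]
  refine Ideal.radical_mono (Ideal.mul_le.2 fun x hx y hy => ?_)
  obtain ⟨i, hi, j, hj, rfl⟩ := Submodule.mem_sup.1 hx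
  obtain ⟨i', hi', k, hk, rfl⟩ := Submodule.mem_sup.1 hy
  have e : (i + j) * (i' + k) = (i * (i' + k) + j * i') + j * k := by ring
  rw [e]
  exact Submodule.add_mem_sup (I.add_mem (I.mul_mem_right _ hi) (I.mul_mem_left _ hi'))
    ⟨J.mul_mem_right _ hj, K.mul_mem_left _ hk⟩

/-- Joins are radicals of sums of ideals, and meets are intersections, i.e. radicals of
products of ideals. -/
instance : DistribLattice (ZariskiLattice R) where
  sup u v := ⟨(u.ideal ⊔ v.ideal).radical, by
    obtain ⟨I, hI, hu⟩ := u.exists_fg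
    obtain ⟨J, hJ, hv⟩ := v.exists_fg
    exact ⟨I ⊔ J, fg_sup hI hJ, by rw [← hu, ← hv]; exact Ideal.radical_sup I J⟩⟩
  le_sup_left u v := le_iff.2 ((le_sup_left : u.ideal ≤ u.ideal ⊔ v.ideal).trans Ideal.le_radical)
  le_sup_right u v :=
    le_iff.2 ((le_sup_right : v.ideal ≤ u.ideal ⊔ v.ideal).trans Ideal.le_radical)
  sup_le u v w h₁ h₂ := le_iff.2 ((w.isRadical.radical_le_iff).2 (sup_le h₁ h₂))
  inf u v := ⟨u.ideal ⊓ v.ideal, by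
    obtain ⟨_, I, hI, rfl⟩ := u
    obtain ⟨_, J, hJ, rfl⟩ := v
    exact ⟨I * J, Ideal.FG.mul hI hJ, Ideal.radical_mul I J⟩⟩
  inf_le_left u v := le_iff.2 inf_le_left
  inf_le_right u v := le_iff.2 inf_le_right
  le_inf u v w h₁ h₂ := le_iff.2 (le_inf h₁ h₂)
  le_sup_inf u v w := le_iff.2 (radical_sup_inf_le u.ideal v.ideal w.ideal)

instance : BoundedOrder (ZariskiLattice R) where
  top := ⟨⊤, ⊤, ⟨{1}, by simp⟩, Ideal.radical_top R⟩
  le_top _ := le_iff.2 le_top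
  bot := ofFG ⊥ Submodule.fg_bot
  bot_le u := le_iff.2 ((u.isRadical.radical_le_iff).2 bot_le)

theorem sup_ideal (u v : ZariskiLattice R) : (u ⊔ v).ideal = (u.ideal ⊔ v.ideal).radical := rfl

theorem inf_ideal (u v : ZariskiLattice R) : (u ⊓ v).ideal = u.ideal ⊓ v.ideal := rfl

theorem top_ideal : (⊤ : ZariskiLattice R).ideal = ⊤ := rfl

theorem bot_ideal : (⊥ : ZariskiLattice R).ideal = (⊥ : Ideal R).radical := rfl

/-- The basic open `D(f)`. -/
def D (f : R) : ZariskiLattice R   := ofFG (Ideal.span {f}) ⟨{f}, by simp⟩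

theorem D_le_iff {f : R} {u : ZariskiLattice R} : D f ≤ u ↔ f ∈ u.ideal :=
  (u.isRadical.radical_le_iff).trans (by simp [Ideal.span_le])

theorem mem_D_iff {f g : R} : g ∈ (D f).ideal ↔ ∃ n : ℕ, f ∣ g ^ n := by
  simp [D, ofFG, Ideal.mem_radical_iff, Ideal.mem_span_singleton]

theorem D_mul (f g : R) : D (f * g) = D f ⊓ D g := ZariskiLattice.ext <| by
  rw [inf_ideal]
  simp [D, ofFG, ← Ideal.span_singleton_mul_span_singleton, Ideal.radical_mul]

theorem D_one : D (1 : R) = ⊤ := ZariskiLattice.ext <| by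
  simp [D, ofFG, top_ideal]

theorem D_zero : D (0 : R) = ⊥ := ZariskiLattice.ext <| by
  simp [D, ofFG, bot_ideal]

theorem D_add_le (f g : R) : D (f + g) ≤ D f ⊔ D g := by
  rw [D_le_iff, sup_ideal]
  exact Ideal.le_radical (Ideal.add_mem _
    (Ideal.mem_sup_left (D_le_iff.1 le_rfl)) (Ideal.mem_sup_right (D_le_iff.1 le_rfl)))

theorem isSupport_D : IsSupport (D : R → ZariskiLattice R) :=
  ⟨D_zero, D_one, D_mul, D_add_le⟩

theorem D_le_D_of_dvd {f g : R} (h : f ∣ g) : D g ≤ D f :=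
  D_le_iff.2 (mem_D_iff.2 ⟨1, by simpa using h⟩)

theorem le_of_forall_D {u v : ZariskiLattice R} (h : ∀ f, D f ≤ u → D f ≤ v) : u ≤ v :=
  le_iff.2 fun f hf => D_le_iff.1 (h f (D_le_iff.2 hf))

theorem D_eq_top_iff {f : R} : D f = ⊤ ↔ IsUnit f := by
  rw [← top_le_iff, ← D_one, D_le_iff, mem_D_iff]
  simp [isUnit_iff_dvd_one]

/-- The lattice homomorphism `𝓛_R → 𝓛_A` induced by a ring homomorphism `φ : R → A`, sending
`D(f₁, …, fₙ)` to `D(φ f₁, …, φ fₙ)`. -/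
def map (φ : R →+* A) : BoundedLatticeHom (ZariskiLattice R) (ZariskiLattice A) where
  toFun u := ⟨(u.ideal.map φ).radical, by
    obtain ⟨_, I, hI, rfl⟩ := u
    refine ⟨I.map φ, hI.map φ, le_antisymm (Ideal.radical_mono (Ideal.map_mono Ideal.le_radical))
      (Ideal.radical_le_radical_iff.2 (Ideal.map_radical_le φ))⟩⟩
  map_sup' u v := ZariskiLattice.ext <| by
    simp only [sup_ideal]
    rw [← Ideal.radical_sup, ← Ideal.map_sup]
    exact le_antisymm (Ideal.radical_le_radical_iff.2 (Ideal.map_radical_le φ))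
      (Ideal.radical_mono (Ideal.map_mono Ideal.le_radical))
  map_inf' u v := ZariskiLattice.ext <| by
    simp only [inf_ideal]
    rw [← Ideal.radical_mul, ← Ideal.map_mul, ← u.isRadical.radical, ← v.isRadical.radical,
      ← Ideal.radical_mul, u.isRadical.radical, v.isRadical.radical]
    exact le_antisymm (Ideal.radical_le_radical_iff.2 (Ideal.map_radical_le φ))
      (Ideal.radical_mono (Ideal.map_mono Ideal.le_radical))
  map_top' := ZariskiLattice.ext <| by simp [top_ideal, Ideal.map_top]
  map_bot' := ZariskiLattice.ext <| by
    simp only [bot_ideal]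
    refine le_antisymm (Ideal.radical_le_radical_iff.2 ?_) (Ideal.radical_mono bot_le)
    exact (Ideal.map_radical_le φ).trans (by rw [Ideal.map_bot])

theorem map_ideal (φ : R →+* A) (u : ZariskiLattice R) : (map φ u).ideal = (u.ideal.map φ).radical := rfl

theorem map_le_iff {φ : R →+* A} {u : ZariskiLattice R} {v : ZariskiLattice A} :
    map φ u ≤ v ↔ ∀ f, D f ≤ u → D (φ f) ≤ v := by
  rw [le_iff, map_ideal, v.isRadical.radical_le_iff, Ideal.map_le_iff_le_comap]
  exact ⟨fun h f hf => D_le_iff.2 (h (D_le_iff.1 hf)),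
    fun h f hf => D_le_iff.1 (h f (D_le_iff.2 hf))⟩

theorem D_le_map {φ : R →+* A} {u : ZariskiLattice R} {f : R} (h : D f ≤ u) :
    D (φ f) ≤ map φ u := map_le_iff.1 le_rfl f h

theorem map_D (φ : R →+* A) (f : R) : map φ (D f) = D (φ f) := by
  refine le_antisymm (map_le_iff.2 fun g hg => ?_) (D_le_map le_rfl)
  obtain ⟨n, hn⟩ := mem_D_iff.1 (D_le_iff.1 hg)
  exact D_le_iff.2 (mem_D_iff.2 ⟨n, by simpa using map_dvd φ hn⟩)

theorem map_id (u : ZariskiLattice R) : map (RingHom.id R) u = u := ZariskiLattice.ext <| by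
  rw [map_ideal, Ideal.map_id, u.isRadical.radical]

theorem map_comp (ψ : A →+* B) (φ : R →+* A) (u : ZariskiLattice R) :
    map (ψ.comp φ) u = map ψ (map φ u) := ZariskiLattice.ext <| by
  simp only [map_ideal]
  refine le_antisymm ?_ (Ideal.radical_le_radical_iff.2 ?_)
  · rw [← Ideal.map_map]
    exact Ideal.radical_mono (Ideal.map_mono Ideal.le_radical)
  · rw [← Ideal.map_map]
    exact Ideal.map_radical_le ψ

/-- A family of elements of `R` covers `u` if `u` lies below the radical of the ideal generated
by the family. -/
def Covers {ι : Type*} (f : ι → R) (u : ZariskiLattice R) : Prop :=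
  u.ideal ≤ (Ideal.span (Set.range f)).radical

theorem Covers.map {ι : Type*} {f : ι → R} {u : ZariskiLattice R} (h : Covers f u) (φ : R →+* A) :
    Covers (φ ∘ f) (map φ u) := by
  unfold Covers at *
  rw [map_ideal, Set.range_comp, ← Ideal.map_span]
  exact Ideal.radical_le_radical_iff.2 ((Ideal.map_mono h).trans (Ideal.map_radical_le φ))

theorem Covers.mono {ι : Type*} {f : ι → R} {u v : ZariskiLattice R} (h : Covers f u)
    (hv : v ≤ u) : Covers f v := (le_iff.1 hv).trans h

theorem Covers.le {ι : Type*} {f : ι → R} {u v : ZariskiLattice R} (h : Covers f u)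
    (hv : ∀ i, D (f i) ≤ v) : u ≤ v :=
  le_iff.2 (h.trans ((v.isRadical.radical_le_iff).2
    (Ideal.span_le.2 (by rintro _ ⟨i, rfl⟩; exact D_le_iff.1 (hv i)))))

theorem covers_self (u : ZariskiLattice R) : Covers (fun f : { f : R // D f ≤ u } => f.1) u :=
  fun f hf => Ideal.le_radical (Ideal.subset_span ⟨⟨f, D_le_iff.2 hf⟩, rfl⟩)

theorem exists_fin (u : ZariskiLattice R) :
    ∃ s : Finset R, (Ideal.span (s : Set R)).radical = u.ideal := by
  obtain ⟨_, J, hJ, rfl⟩ := u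
  obtain ⟨s, hs⟩ := hJ
  exact ⟨s, congrArg Ideal.radical hs⟩

end ZariskiLattice

namespace ZariskiLattice

variable {R A B : Type u} [CommRing R] [CommRing A] [CommRing B]

theorem isUnit_algebraMap_iff {f g : R} :
    IsUnit (algebraMap R (Localization.Away g) f) ↔ D g ≤ D f := by
  rw [IsLocalization.Away.algebraMap_isUnit_iff g, D_le_iff, mem_D_iff]

/-- The canonical map `R_f → R_g` for `D(g) ≤ D(f)`. -/
noncomputable def awayRes {f g : R} (h : D g ≤ D f) :
    Localization.Away f →+* Localization.Away g :=
  Localization.awayLift (algebraMap R (Localization.Away g)) f (isUnit_algebraMap_iff.2 h)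

theorem away_hom_ext {f : R} {P : Type*} [CommRing P] {α β : Localization.Away f →+* P}
    (h : ∀ r : R, α (algebraMap R _ r) = β (algebraMap R _ r)) (x : Localization.Away f) :
    α x = β x :=
  RingHom.congr_fun (IsLocalization.ringHom_ext (Submonoid.powers f) (RingHom.ext h)) x

theorem awayLift_algebraMap {P : Type*} [CommRing P] (φ : R →+* P) (f : R) (h : IsUnit (φ f))
    (r : R) : Localization.awayLift φ f h (algebraMap R _ r) = φ r :=
  IsLocalization.Away.lift_eq f h r

theorem awayRes_algebraMap {f g : R} (h : D g ≤ D f) (r : R) :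
    awayRes h (algebraMap R _ r) = algebraMap R _ r :=
  awayLift_algebraMap _ _ (isUnit_algebraMap_iff.2 h) r

theorem awayRes_self {f : R} (h : D f ≤ D f) (x : Localization.Away f) : awayRes h x = x :=
  away_hom_ext (α := awayRes h) (β := RingHom.id _) (fun r => awayRes_algebraMap h r) x

theorem awayRes_awayRes {f g k : R} (h : D g ≤ D f) (h' : D k ≤ D g) (x : Localization.Away f) :
    awayRes h' (awayRes h x) = awayRes (h'.trans h) x :=
  away_hom_ext (α := (awayRes h').comp (awayRes h)) (β := awayRes (h'.trans h))
    (fun r => by simp [awayRes_algebraMap]) x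

theorem awayMap_algebraMap (φ : R →+* A) (f r : R) :
    Localization.awayMap φ f (algebraMap R _ r) = algebraMap A _ (φ r) := by
  simp [Localization.awayMap, IsLocalization.Away.map]

theorem D_map_le {φ : R →+* A} {f g : R} (h : D g ≤ D f) : D (φ g) ≤ D (φ f) := by
  rw [← map_D, ← map_D]
  exact OrderHomClass.mono (map φ) h

theorem awayMap_awayRes (φ : R →+* A) {f g : R} (h : D g ≤ D f) (x : Localization.Away f) :
    Localization.awayMap φ g (awayRes h x) = awayRes (D_map_le h) (Localization.awayMap φ f x) :=
  away_hom_ext (α := (Localization.awayMap φ g).comp (awayRes h))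
    (β := (awayRes (D_map_le h)).comp (Localization.awayMap φ f))
    (fun r => by simp only [RingHom.comp_apply, awayRes_algebraMap, awayMap_algebraMap]) x

/-- Compatibility of a family of sections over basic opens on the pairwise intersections. -/
def Compatible {ι : Type*} (f : ι → R) (t : ∀ i, Localization.Away (f i)) : Prop :=
  ∀ i j, awayRes (D_le_D_of_dvd (Dvd.intro _ rfl)) (t i) =
    (awayRes (D_le_D_of_dvd (Dvd.intro_left _ rfl)) (t j) : Localization.Away (f i * f j))

theorem Compatible.eq {ι : Type*} {f : ι → R} {t : ∀ i, Localization.Away (f i)}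
    (ht : Compatible f t) {i j : ι} {g : R} (hi : D g ≤ D (f i)) (hj : D g ≤ D (f j)) :
    awayRes hi (t i) = awayRes hj (t j) := by
  have h : D g ≤ D (f i * f j) := by rw [D_mul]; exact le_inf hi hj
  simpa only [awayRes_awayRes] using congrArg (awayRes h) (ht i j)

theorem existsUnique_away {ι : Type*} {f : ι → R} {g : R} (hg : Covers f (D g))
    (t : ∀ i, Localization.Away (f i)) (ht : Compatible f t) :
    ∃! r : Localization.Away g, ∀ i (k : R) (h : D k ≤ D g) (h' : D k ≤ D (f i)),
      awayRes h r = awayRes h' (t i) := by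
  let a := algebraMap R (Localization.Away g)
  let s : Set (Localization.Away g) := Set.range (a ∘ f)
  have hs : Ideal.span s = ⊤ := by
    have h := hg.map a
    unfold Covers at h
    rw [map_D, D_eq_top_iff.2 (isUnit_algebraMap_iff.2 le_rfl), top_ideal, top_le_iff,
      Ideal.radical_eq_top] at h
    exact h
  choose σ hσ using fun x : s => x.2
  have hσ : ∀ x : s, a (f (σ x)) = x.1 := hσ
  have hu : ∀ {P : Type u} [CommRing P] (γ : Localization.Away g →+* P) {k : R} (l : R),
      D k ≤ D l → IsUnit (γ (a k)) → IsUnit (γ (a l)) := by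
    intro P _ γ k l hkl hk
    have := D_map_le (φ := γ.comp a) hkl
    rw [show (γ.comp a) k = γ (a k) from rfl, D_eq_top_iff.2 hk, top_le_iff] at this
    exact D_eq_top_iff.1 this
  let T (x : Localization.Away g) : R →+* Localization.Away x :=
    (algebraMap (Localization.Away g) (Localization.Away x)).comp a
  have hT : ∀ (x : s) , IsUnit (T x.1 (f (σ x))) := fun x => by
    simp only [T, RingHom.comp_apply, hσ]
    exact IsLocalization.Away.algebraMap_isUnit _
  let F (x : s) : Localization.Away x.1 := Localization.awayLift (T x.1) (f (σ x)) (hT x) (t (σ x))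
  have key : ∀ (x : s) (i : ι), a (f i) = x.1 → ∀ h : IsUnit (T x.1 (f i)),
      F x = Localization.awayLift (T x.1) (f i) h (t i) := by
    intro x i hi h
    have hprod : IsUnit (T x.1 (f (σ x) * f i)) := by rw [map_mul]; exact (hT x).mul h
    have := congrArg (Localization.awayLift (T x.1) (f (σ x) * f i) hprod) (ht (σ x) i)
    have e1 : ∀ (j : ι) (hd : D (f (σ x) * f i) ≤ D (f j)) (hj : IsUnit (T x.1 (f j)))
        (y : Localization.Away (f j)),
        Localization.awayLift (T x.1) (f (σ x) * f i) hprod (awayRes hd y) =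
          Localization.awayLift (T x.1) (f j) hj y := fun j hd hj y =>
      away_hom_ext (α := (Localization.awayLift (T x.1) (f (σ x) * f i) hprod).comp (awayRes hd))
        (β := Localization.awayLift (T x.1) (f j) hj)
        (fun r => by simp only [RingHom.comp_apply, awayRes_algebraMap, awayLift_algebraMap]) y
    rw [e1 _ _ (hT x), e1 _ _ h] at this
    exact this
  have hF : ∀ x y : s, IsLocalization.Away.awayToAwayRight
      (P := Localization.Away (x.1 * y.1)) x.1 y (F x) =
      IsLocalization.Away.awayToAwayLeft y.1 x (F y) := by
    intro x y
    have hx : IsUnit (T (x.1 * y.1) (f (σ x))) := by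
      simp only [T, RingHom.comp_apply, hσ]
      exact IsLocalization.Away.isUnit_of_dvd (x.1 * y.1) (Dvd.intro _ rfl)
    have hy : IsUnit (T (x.1 * y.1) (f (σ y))) := by
      simp only [T, RingHom.comp_apply, hσ]
      exact IsLocalization.Away.isUnit_of_dvd (x.1 * y.1) (Dvd.intro_left _ rfl)
    have hxy : IsUnit (T (x.1 * y.1) (f (σ x) * f (σ y))) := by rw [map_mul]; exact hx.mul hy
    have e1 := away_hom_ext (α := (IsLocalization.Away.awayToAwayRight
      (P := Localization.Away (x.1 * y.1)) x.1 y.1).comp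
        (Localization.awayLift (T x.1) (f (σ x)) (hT x)))
      (β := (Localization.awayLift (T (x.1 * y.1)) (f (σ x) * f (σ y)) hxy).comp
        (awayRes (D_le_D_of_dvd (Dvd.intro _ rfl))))
      (fun r => by
        simp only [RingHom.comp_apply, awayRes_algebraMap, awayLift_algebraMap, T,
          IsLocalization.Away.awayToAwayRight_eq]) (t (σ x))
    have e2 := away_hom_ext (α := (IsLocalization.Away.awayToAwayLeft
      (P := Localization.Away (x.1 * y.1)) y.1 x.1).comp
        (Localization.awayLift (T y.1) (f (σ y)) (hT y)))
      (β := (Localization.awayLift (T (x.1 * y.1)) (f (σ x) * f (σ y)) hxy).comp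
        (awayRes (D_le_D_of_dvd (Dvd.intro_left _ rfl))))
      (fun r => by
        simp only [RingHom.comp_apply, awayRes_algebraMap, awayLift_algebraMap, T,
          IsLocalization.Away.awayToAwayLeft_eq]) (t (σ y))
    exact e1.trans ((congrArg (Localization.awayLift (T (x.1 * y.1)) _ hxy)
      (ht (σ x) (σ y))).trans e2.symm)
  obtain ⟨r, hr, hr'⟩ := Localization.existsUnique_algebraMap_eq_of_span_eq_top s hs F hF
  refine ⟨r, fun i k h h' => ?_, fun r' h' => hr' r' fun x => ?_⟩
  · let x : s := ⟨a (f i), i, rfl⟩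
    have hx : IsUnit (T x.1 (f i)) := IsLocalization.Away.algebraMap_isUnit x.1
    have h1 : algebraMap _ (Localization.Away x.1) r = _ := (hr x).trans (key x i rfl hx)
    have hw : IsUnit (awayRes h x.1) := by
      change IsUnit (awayRes h (algebraMap R _ (f i)))
      rw [awayRes_algebraMap]
      exact isUnit_algebraMap_iff.2 h'
    have h2 := congrArg (Localization.awayLift (awayRes h) x.1 hw) h1
    rw [awayLift_algebraMap] at h2
    refine h2.trans ?_
    exact away_hom_ext (α := (Localization.awayLift (awayRes h) x.1 hw).comp
      (Localization.awayLift (T x.1) (f i) hx)) (β := awayRes h')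
      (fun r => by
        simp only [RingHom.comp_apply, awayRes_algebraMap, awayLift_algebraMap, T, a]) (t i)
  · have hg' : IsUnit (T x.1 g) :=
      (isUnit_algebraMap_iff.2 (le_refl (D g))).map (algebraMap _ (Localization.Away x.1))
    have hgf : IsUnit (T x.1 (g * f (σ x))) := by rw [map_mul]; exact hg'.mul (hT x)
    have h1 := congrArg (Localization.awayLift (T x.1) _ hgf)
      (h' (σ x) (g * f (σ x)) (D_le_D_of_dvd (Dvd.intro _ rfl))
        (D_le_D_of_dvd (Dvd.intro_left _ rfl)))
    have e1 := away_hom_ext (α := algebraMap _ (Localization.Away x.1))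
      (β := (Localization.awayLift (T x.1) _ hgf).comp
        (awayRes (D_le_D_of_dvd (Dvd.intro (f (σ x)) rfl))))
      (fun r => by
        simp only [RingHom.comp_apply, awayRes_algebraMap, awayLift_algebraMap, T, a]) r'
    have e2 := away_hom_ext (α := Localization.awayLift (T x.1) (f (σ x)) (hT x))
      (β := (Localization.awayLift (T x.1) _ hgf).comp
        (awayRes (D_le_D_of_dvd (Dvd.intro_left g rfl))))
      (fun r => by
        simp only [RingHom.comp_apply, awayRes_algebraMap, awayLift_algebraMap]) (t (σ x))
    exact e1.trans (h1.trans e2.symm)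

/-- The sections of the structure sheaf over `u`: the limit of the localizations `R_f` over the
basic opens `D(f) ≤ u`, i.e. the value at `u` of the right Kan extension of `D(f) ↦ R_f` from
the basic opens to the Zariski lattice. -/
def structureSections (u : ZariskiLattice R) :
    Subring (∀ f : { f : R // D f ≤ u }, Localization.Away f.1) where
  carrier := { s | ∀ (f g : { f : R // D f ≤ u }) (h : D g.1 ≤ D f.1), awayRes h (s f) = s g }
  mul_mem' hs ht f g h := by simp only [Pi.mul_apply, map_mul, hs f g h, ht f g h]
  one_mem' f g h := by simp only [Pi.one_apply, map_one]
  add_mem' hs ht f g h := by simp only [Pi.add_apply, map_add, hs f g h, ht f g h]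
  zero_mem' f g h := by simp only [Pi.zero_apply, map_zero]
  neg_mem' hs f g h := by simp only [Pi.neg_apply, map_neg, hs f g h]

/-- The component in `R_f` of a section over `u`, for `D(f) ≤ u`. -/
def component {u : ZariskiLattice R} (f : R) (hf : D f ≤ u) :
    structureSections u →+* Localization.Away f :=
  (Pi.evalRingHom _ (⟨f, hf⟩ : { f : R // D f ≤ u })).comp (structureSections u).subtype

theorem awayRes_component {u : ZariskiLattice R} {f g : R} (hf : D f ≤ u) (h : D g ≤ D f)
    (s : structureSections u) : awayRes h (component f hf s) = component g (h.trans hf) s :=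
  s.2 ⟨f, hf⟩ ⟨g, h.trans hf⟩ h

theorem section_ext {u : ZariskiLattice R} {s t : structureSections u}
    (h : ∀ f hf, component f hf s = component f hf t) : s = t :=
  Subtype.ext (funext fun f => h f.1 f.2)

/-- Restriction of sections of the structure sheaf. -/
def sectionRes {u v : ZariskiLattice R} (h : v ≤ u) :
    structureSections u →+* structureSections v where
  toFun s := ⟨fun f => component f.1 (f.2.trans h) s,
    fun f _ hg => awayRes_component (f.2.trans h) hg s⟩
  map_one' := section_ext fun f hf => map_one (component f (hf.trans h))
  map_mul' s t := section_ext fun f hf => map_mul (component f (hf.trans h)) s t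
  map_zero' := section_ext fun f hf => map_zero (component f (hf.trans h))
  map_add' s t := section_ext fun f hf => map_add (component f (hf.trans h)) s t

theorem component_sectionRes {u v : ZariskiLattice R} (h : v ≤ u) (s : structureSections u)
    (f : R) (hf : D f ≤ v) : component f hf (sectionRes h s) = component f (hf.trans h) s := rfl

/-- Sections agreeing on a cover by basic opens are equal. -/
theorem section_ext_of_covers {ι : Type*} {f : ι → R} {u : ZariskiLattice R} (hu : Covers f u)
    {s t : structureSections u}
    (h : ∀ i (hi : D (f i) ≤ u), component (f i) hi s = component (f i) hi t)
    (hf : ∀ i, D (f i) ≤ u) : s = t := by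
  refine section_ext fun g hg => ?_
  have hc : Compatible f fun i => component (f i) (hf i) s := fun i j => by
    rw [awayRes_component, awayRes_component]
  refine (existsUnique_away (hu.mono hg) _ hc).unique (fun i k hk hk' => ?_) fun i k hk hk' => ?_
  · rw [awayRes_component, awayRes_component]
  · rw [h, awayRes_component, awayRes_component]

/-- Compatible sections over a cover by basic opens glue. -/
theorem existsUnique_section {ι : Type*} {f : ι → R} {u : ZariskiLattice R} (hu : Covers f u)
    (hf : ∀ i, D (f i) ≤ u) (t : ∀ i, Localization.Away (f i)) (ht : Compatible f t) :
    ∃! s : structureSections u, ∀ i, component (f i) (hf i) s = t i := by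
  choose r hr hr' using fun g : { g : R // D g ≤ u } => existsUnique_away (hu.mono g.2) t ht
  refine ⟨⟨r, fun g k h => hr' k _ fun i l hl hl' => ?_⟩, fun i => ?_, fun s hs =>
    section_ext_of_covers hu (fun i hi => (hs i).trans ?_) hf⟩
  · rw [awayRes_awayRes]
    exact hr g i l _ hl'
  · exact (hr' ⟨f i, hf i⟩ (t i) fun j k h h' => ht.eq h h').symm
  · exact hr' ⟨f i, hf i⟩ (t i) fun j k h h' => ht.eq h h'

end ZariskiLattice

namespace ZariskiLattice

variable {R A B : Type u} [CommRing R] [CommRing A] [CommRing B]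

/-! ### Functoriality of the structure sheaf -/

theorem isUnit_map_iff {φ : R →+* A} {f : R} {g : A} :
    IsUnit (((algebraMap A (Localization.Away g)).comp φ) f) ↔ D g ≤ D (φ f) :=
  isUnit_algebraMap_iff

/-- The map `R_f → A_g` induced by `φ : R → A` when `D(g) ≤ D(φ f)`. -/
noncomputable def awayPull (φ : R →+* A) {f : R} {g : A} (h : D g ≤ D (φ f)) :
    Localization.Away f →+* Localization.Away g :=
  Localization.awayLift ((algebraMap A (Localization.Away g)).comp φ) f (isUnit_map_iff.2 h)

theorem awayPull_algebraMap {φ : R →+* A} {f : R} {g : A} (h : D g ≤ D (φ f)) (r : R) :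
    awayPull φ h (algebraMap R _ r) = algebraMap A _ (φ r) :=
  awayLift_algebraMap _ _ (isUnit_map_iff.2 h) r

theorem awayRes_awayPull {φ : R →+* A} {f : R} {g k : A} (h : D g ≤ D (φ f)) (hk : D k ≤ D g)
    (x : Localization.Away f) : awayRes hk (awayPull φ h x) = awayPull φ (hk.trans h) x :=
  away_hom_ext (α := (awayRes hk).comp (awayPull φ h)) (β := awayPull φ (hk.trans h))
    (fun r => by simp only [RingHom.comp_apply, awayRes_algebraMap, awayPull_algebraMap]) x

theorem awayPull_awayRes {φ : R →+* A} {f f' : R} {g : A} (h : D f' ≤ D f)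
    (hg : D g ≤ D (φ f')) (x : Localization.Away f) :
    awayPull φ hg (awayRes h x) = awayPull φ (hg.trans (D_map_le h)) x :=
  away_hom_ext (α := (awayPull φ hg).comp (awayRes h)) (β := awayPull φ (hg.trans (D_map_le h)))
    (fun r => by simp only [RingHom.comp_apply, awayRes_algebraMap, awayPull_algebraMap]) x

theorem awayPull_awayPull {φ : R →+* A} {ψ : A →+* B} {f : R} {g : A} {k : B}
    (h : D g ≤ D (φ f)) (hk : D k ≤ D (ψ g)) (x : Localization.Away f) :
    awayPull ψ hk (awayPull φ h x) =
      awayPull (ψ.comp φ) (hk.trans (D_map_le (φ := ψ) h)) x :=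
  away_hom_ext (α := (awayPull ψ hk).comp (awayPull φ h))
    (β := awayPull (ψ.comp φ) (hk.trans (D_map_le (φ := ψ) h)))
    (fun r => by simp only [RingHom.comp_apply, awayPull_algebraMap]) x

theorem awayPull_id {f g : R} (h : D g ≤ D f) (x : Localization.Away f) :
    awayPull (RingHom.id R) h x = awayRes h x := rfl

theorem covers_map (φ : R →+* A) (u : ZariskiLattice R) :
    Covers (fun f : { f : R // D f ≤ u } => φ f.1) (map φ u) :=
  (covers_self u).map φ

theorem existsUnique_sectionMap (φ : R →+* A) {u : ZariskiLattice R} (s : structureSections u) :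
    ∃! t : structureSections (map φ u), ∀ f : { f : R // D f ≤ u },
      component (φ f.1) (D_le_map f.2) t = awayPull φ le_rfl (component f.1 f.2 s) := by
  refine existsUnique_section (f := fun f : { f : R // D f ≤ u } => φ f.1) (covers_map φ u) _ _ ?_
  intro f g
  have h1 : D (f.1 * g.1) ≤ D f.1 := D_le_D_of_dvd (Dvd.intro _ rfl)
  have h2 : D (f.1 * g.1) ≤ D g.1 := D_le_D_of_dvd (Dvd.intro_left _ rfl)
  have h3 : D (φ f.1 * φ g.1) ≤ D (φ (f.1 * g.1)) := by rw [map_mul]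
  rw [awayRes_awayPull, awayRes_awayPull,
    ← awayPull_awayRes h1 h3, ← awayPull_awayRes h2 h3, awayRes_component, awayRes_component]

/-- The map `𝓞_R(u) → 𝓞_A(φ(u))` induced by a ring homomorphism `φ : R → A`, as a function: the
unique extension of the canonical maps `R_f → A_{φ f}` on basic opens. -/
noncomputable def sectionMapFun (φ : R →+* A) {u : ZariskiLattice R} (s : structureSections u) :
    structureSections (map φ u) :=
  (existsUnique_sectionMap φ s).choose

theorem component_sectionMapFun (φ : R →+* A) {u : ZariskiLattice R} (s : structureSections u)
    {f : R} (hf : D f ≤ u) :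
    component (φ f) (D_le_map hf) (sectionMapFun φ s) = awayPull φ le_rfl (component f hf s) :=
  (existsUnique_sectionMap φ s).choose_spec.1 ⟨f, hf⟩

theorem eq_sectionMapFun (φ : R →+* A) {u : ZariskiLattice R} {s : structureSections u}
    {t : structureSections (map φ u)}
    (h : ∀ f (hf : D f ≤ u),
      component (φ f) (D_le_map hf) t = awayPull φ le_rfl (component f hf s)) :
    t = sectionMapFun φ s :=
  (existsUnique_sectionMap φ s).choose_spec.2 t fun f => h f.1 f.2

/-- The ring homomorphism `𝓞_R(u) → 𝓞_A(φ(u))` induced by `φ : R → A`. -/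
noncomputable def sectionMap (φ : R →+* A) (u : ZariskiLattice R) :
    structureSections u →+* structureSections (map φ u) where
  toFun := sectionMapFun φ
  map_one' := (eq_sectionMapFun φ fun f hf => by simp only [map_one]).symm
  map_zero' := (eq_sectionMapFun φ fun f hf => by simp only [map_zero]).symm
  map_mul' s t := (eq_sectionMapFun φ fun f hf => by
    simp only [map_mul, component_sectionMapFun _ _ hf]).symm
  map_add' s t := (eq_sectionMapFun φ fun f hf => by
    simp only [map_add, component_sectionMapFun _ _ hf]).symm

theorem component_sectionMap (φ : R →+* A) {u : ZariskiLattice R} (s : structureSections u)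
    {f : R} {g : A} (hf : D f ≤ u) (h : D g ≤ D (φ f)) (hg : D g ≤ map φ u) :
    component g hg (sectionMap φ u s) = awayPull φ h (component f hf s) := by
  rw [← awayRes_component (D_le_map hf) h]
  change awayRes h (component (φ f) (D_le_map hf) (sectionMapFun φ s)) = _
  rw [component_sectionMapFun, awayRes_awayPull]

theorem sectionRes_sectionMap (φ : R →+* A) {u v : ZariskiLattice R} (h : v ≤ u)
    (h' : map φ v ≤ map φ u) (s : structureSections u) :
    sectionRes h' (sectionMap φ u s) = sectionMap φ v (sectionRes h s) :=
  section_ext_of_covers (covers_map φ v)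
    (fun f hf => by
      rw [component_sectionRes, component_sectionMap φ s (f.2.trans h) le_rfl,
        component_sectionMap φ _ f.2 le_rfl, component_sectionRes])
    fun f => D_le_map f.2

theorem sectionMap_id {u : ZariskiLattice R} (s : structureSections u)
    (h : u ≤ map (RingHom.id R) u) : sectionRes h (sectionMap (RingHom.id R) u s) = s :=
  section_ext fun f hf => by
    refine (component_sectionMap (RingHom.id R) s hf (le_refl (D f)) (hf.trans h)).trans ?_
    exact awayRes_self (le_refl (D f)) (component f hf s)

theorem sectionMap_comp (ψ : A →+* B) (φ : R →+* A) {u : ZariskiLattice R}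
    (s : structureSections u) (h : map ψ (map φ u) ≤ map (ψ.comp φ) u) :
    sectionRes h (sectionMap (ψ.comp φ) u s) = sectionMap ψ (map φ u) (sectionMap φ u s) :=
  section_ext_of_covers ((covers_map φ u).map ψ)
    (fun f hf => by
      refine (component_sectionMap (ψ.comp φ) s f.2 (le_refl (D (ψ (φ f.1)))) (hf.trans h)).trans
        (Eq.trans ?_ (component_sectionMap ψ (sectionMap φ u s) (D_le_map f.2)
          (le_refl (D (ψ (φ f.1)))) hf).symm)
      rw [component_sectionMap φ _ f.2 le_rfl, awayPull_awayPull])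
    fun f => D_le_map (D_le_map f.2)

/-! ### Sections over the top element -/

/-- An element of `R` as a global section of the structure sheaf. -/
def ofRing : R →+* structureSections (⊤ : ZariskiLattice R) where
  toFun r := ⟨fun _ => algebraMap R _ r, fun _ _ h => awayRes_algebraMap h r⟩
  map_one' := section_ext fun f _ => map_one (algebraMap R (Localization.Away f))
  map_zero' := section_ext fun f _ => map_zero (algebraMap R (Localization.Away f))
  map_mul' r r' := section_ext fun f _ => map_mul (algebraMap R (Localization.Away f)) r r'
  map_add' r r' := section_ext fun f _ => map_add (algebraMap R (Localization.Away f)) r r'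

theorem component_ofRing (r : R) (f : R) (hf : D f ≤ ⊤) :
    component f hf (ofRing r) = algebraMap R _ r := rfl

theorem algebraMap_one_bijective :
    Function.Bijective (algebraMap R (Localization.Away (1 : R))) :=
  (IsLocalization.atUnit R (Localization.Away (1 : R)) 1 isUnit_one).bijective

theorem ofRing_bijective : Function.Bijective (ofRing : R → structureSections ⊤) := by
  refine ⟨fun r r' h => algebraMap_one_bijective.1 ?_, fun s => ?_⟩
  · exact congrArg (component 1 le_top) h
  · obtain ⟨r, hr⟩ := algebraMap_one_bijective.2 (component 1 le_top s)
    refine ⟨r, section_ext fun f hf => ?_⟩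
    have h1 : D f ≤ D 1 := by rw [D_one]; exact le_top
    rw [component_ofRing, ← awayRes_component le_top h1 s, ← hr, awayRes_algebraMap]

/-! ### Invertibility suprema -/

/-- The elements `f` with `D(f) ≤ u` such that the component of `s` in `R_f` is invertible. -/
def invSet {u : ZariskiLattice R} (s : structureSections u) : Set R :=
  { f | ∃ h : D f ≤ u, IsUnit (component f h s) }

theorem isUnit_component_of_covers {u : ZariskiLattice R} (s : structureSections u) {ι : Type*}
    {g : ι → R} {f : R} (hf : D f ≤ u) (hc : Covers g (D f)) (hg : ∀ i, g i ∈ invSet s) :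
    IsUnit (component f hf s) := by
  choose hgu hgs using hg
  choose t ht using fun i => (isUnit_iff_exists_inv.1 (hgs i))
  have htc : Compatible g t := fun i j => by
    have e1 := congrArg (awayRes (D_le_D_of_dvd (Dvd.intro (g j) rfl))) (ht i)
    have e2 := congrArg (awayRes (D_le_D_of_dvd (Dvd.intro_left (g i) rfl))) (ht j)
    rw [map_mul, map_one, awayRes_component] at e1 e2
    exact left_inv_eq_right_inv ((mul_comm _ _).trans e1) e2
  obtain ⟨r, hr, _⟩ := existsUnique_away hc t htc
  have h1 : Compatible g fun i => 1 := fun i j => by rw [map_one, map_one]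
  refine isUnit_iff_exists_inv.2 ⟨r, (existsUnique_away hc _ h1).unique ?_ ?_⟩
  · intro i k h h'
    rw [map_mul, hr i k h h', awayRes_component hf h, ← awayRes_component (hgu i) h', ← map_mul, ht]
  · intro i k h h'
    rw [map_one, map_one]

theorem mem_invSet_of_mem_radical {u : ZariskiLattice R} (s : structureSections u) {f : R}
    (hf : f ∈ (Ideal.span (invSet s)).radical) : f ∈ invSet s := by
  have hu : D f ≤ u := D_le_iff.2 (((u.isRadical.radical_le_iff).2
    (Ideal.span_le.2 fun g hg => D_le_iff.1 hg.1)) hf)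
  refine ⟨hu, isUnit_component_of_covers s (ι := invSet s) (g := Subtype.val) hu ?_ fun i => i.2⟩
  rw [Covers, Subtype.range_coe]
  exact (Ideal.radical_isRadical _).radical_le_iff.2 (by simpa using hf)

theorem mul_mem_invSet {u : ZariskiLattice R} (s : structureSections u) {f a : R} {n : ℕ}
    (hf : D f ≤ u) (h : component f hf s * algebraMap R _ f ^ n = algebraMap R _ a) :
    f * a ∈ invSet s := by
  have hd : D (f * a) ≤ D f := D_le_D_of_dvd (Dvd.intro _ rfl)
  refine ⟨hd.trans hf, ?_⟩
  have e := congrArg (awayRes hd) h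
  rw [map_mul, awayRes_component, awayRes_algebraMap] at e
  refine isUnit_of_mul_isUnit_left (y := awayRes hd (algebraMap R _ f ^ n)) ?_
  rw [e]
  exact isUnit_algebraMap_iff.2 (D_le_D_of_dvd (Dvd.intro_left _ rfl))

theorem D_le_of_covers {ι : Type*} {f : ι → R} {k : R} {v : ZariskiLattice R}
    (hc : Covers f (D k)) (hv : ∀ i, D (k * f i) ≤ v) : D k ≤ v := by
  obtain ⟨n, hn⟩ := hc (D_le_iff.1 (le_refl (D k)))
  have key : ∀ x ∈ Ideal.span (Set.range f), k * x ∈ v.ideal := by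
    intro x hx
    induction hx using Submodule.span_induction with
    | mem x hx => obtain ⟨i, rfl⟩ := hx; exact D_le_iff.1 (hv i)
    | zero => simp
    | add x y _ _ hx hy => rw [mul_add]; exact add_mem hx hy
    | smul a x _ hx => rw [smul_eq_mul, mul_left_comm]; exact v.ideal.mul_mem_left a hx
  refine D_le_iff.2 (v.isRadical ⟨n + 1, ?_⟩)
  rw [pow_succ']
  exact key _ hn

theorem exists_fg_invSet {u : ZariskiLattice R} (s : structureSections u) :
    ∃ J : Ideal R, J.FG ∧ J.radical = (Ideal.span (invSet s)).radical := by
  obtain ⟨S, hS⟩ := u.exists_fin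
  have hSu : ∀ f : S, D f.1 ≤ u := fun f =>
    D_le_iff.2 (hS ▸ Ideal.le_radical (Ideal.subset_span f.2))
  choose n a ha using fun f : S => IsLocalization.Away.surj f.1 (component f.1 (hSu f) s)
  have hfg : (Ideal.span (Set.range fun f : S => f.1 * a f)).FG :=
    Submodule.fg_span (Set.finite_range _)
  refine ⟨_, hfg, le_antisymm (Ideal.radical_mono (Ideal.span_mono ?_))
    (Ideal.radical_le_radical_iff.2 (Ideal.span_le.2 ?_))⟩
  · rintro _ ⟨f, rfl⟩
    exact mul_mem_invSet s (hSu f) (ha f)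
  · rintro k ⟨hk, hks⟩
    suffices h : D k ≤ ofFG _ hfg from D_le_iff.1 h
    refine D_le_of_covers (f := fun f : S => f.1) ?_ fun f => ?_
    · refine (le_iff.1 hk).trans ?_
      rw [← hS, Subtype.range_coe_subtype]
      exact le_rfl
    · have h1 : D (k * f.1) ≤ D k := D_le_D_of_dvd (Dvd.intro _ rfl)
      have h2 : D (k * f.1) ≤ D f.1 := D_le_D_of_dvd (Dvd.intro_left _ rfl)
      have hfu : IsUnit (algebraMap R (Localization.Away (k * f.1)) f.1) :=
        isUnit_algebraMap_iff.2 h2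
      have e := congrArg (awayRes h2) (ha f)
      rw [map_mul, awayRes_component, map_pow, awayRes_algebraMap, awayRes_algebraMap,
        ← awayRes_component hk h1] at e
      have hau : IsUnit (algebraMap R (Localization.Away (k * f.1)) (a f)) := by
        rw [← e]
        exact (hks.map (awayRes h1)).mul (hfu.pow _)
      have : D (k * f.1) ≤ D (f.1 * a f) := by
        rw [← isUnit_algebraMap_iff, map_mul]
        exact hfu.mul hau
      exact this.trans (D_le_iff.2 (Ideal.le_radical (Ideal.subset_span ⟨f, rfl⟩)))

/-- The invertibility supremum of a section `s`: the join of the basic opens `D(f) ≤ u` over which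
`s` becomes invertible. -/
def invSup {u : ZariskiLattice R} (s : structureSections u) : ZariskiLattice R :=
  ⟨(Ideal.span (invSet s)).radical, exists_fg_invSet s⟩

theorem D_le_invSup {u : ZariskiLattice R} {s : structureSections u} {f : R} :
    D f ≤ invSup s ↔ ∃ h : D f ≤ u, IsUnit (component f h s) :=
  D_le_iff.trans ⟨mem_invSet_of_mem_radical s,
    fun h => Ideal.le_radical (Ideal.subset_span h)⟩

theorem invSup_le {u : ZariskiLattice R} (s : structureSections u) : invSup s ≤ u :=
  le_of_forall_D fun _ hf => (D_le_invSup.1 hf).1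

theorem isUnit_section_iff {u : ZariskiLattice R} {s : structureSections u} :
    IsUnit s ↔ ∀ f (hf : D f ≤ u), IsUnit (component f hf s) := by
  refine ⟨fun h f hf => h.map (component f hf), fun h => ?_⟩
  choose t ht using fun f : { f : R // D f ≤ u } => isUnit_iff_exists_inv.1 (h f.1 f.2)
  refine isUnit_iff_exists_inv.2 ⟨⟨t, fun f g hfg => ?_⟩, section_ext fun f hf => ht ⟨f, hf⟩⟩
  have e1 := congrArg (awayRes hfg) (ht f)
  rw [map_mul, map_one, awayRes_component] at e1
  exact left_inv_eq_right_inv ((mul_comm _ _).trans e1) (ht g)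

theorem le_invSup_iff {u w : ZariskiLattice R} (h : w ≤ u) (s : structureSections u) :
    w ≤ invSup s ↔ IsUnit (sectionRes h s) := by
  rw [isUnit_section_iff]
  exact ⟨fun hw f hf => (D_le_invSup.1 (hf.trans hw)).2,
    fun hw => le_of_forall_D fun f hf => D_le_invSup.2 ⟨hf.trans h, hw f hf⟩⟩

theorem invSup_zero (u : ZariskiLattice R) : invSup (0 : structureSections u) = ⊥ := by
  rw [← le_bot_iff]
  refine le_of_forall_D fun f hf => ?_
  obtain ⟨_, h⟩ := D_le_invSup.1 hf
  rw [map_zero, ← map_zero (algebraMap R _), isUnit_algebraMap_iff, D_zero] at h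
  exact h

theorem invSup_one (u : ZariskiLattice R) : invSup (1 : structureSections u) = u :=
  le_antisymm (invSup_le _) (le_of_forall_D fun f hf => D_le_invSup.2 ⟨hf, by simp⟩)

theorem invSup_mul {u : ZariskiLattice R} (s t : structureSections u) :
    invSup (s * t) = invSup s ⊓ invSup t := by
  refine le_antisymm (le_of_forall_D fun f hf => ?_) (le_of_forall_D fun f hf => ?_)
  · obtain ⟨h, h'⟩ := D_le_invSup.1 hf
    rw [map_mul, IsUnit.mul_iff] at h'
    exact le_inf (D_le_invSup.2 ⟨h, h'.1⟩) (D_le_invSup.2 ⟨h, h'.2⟩)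
  · obtain ⟨h, h'⟩ := D_le_invSup.1 (hf.trans inf_le_left)
    obtain ⟨_, h''⟩ := D_le_invSup.1 (hf.trans inf_le_right)
    exact D_le_invSup.2 ⟨h, by rw [map_mul]; exact h'.mul h''⟩

theorem invSup_add_le {u : ZariskiLattice R} (s t : structureSections u) :
    invSup (s + t) ≤ invSup s ⊔ invSup t := by
  refine le_of_forall_D fun f hf => ?_
  obtain ⟨h, h'⟩ := D_le_invSup.1 hf
  obtain ⟨n, a, ha⟩ := IsLocalization.Away.surj f (component f h s)
  obtain ⟨m, b, hb⟩ := IsLocalization.Away.surj f (component f h t)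
  have hfu : IsUnit (algebraMap R (Localization.Away f) f) := isUnit_algebraMap_iff.2 le_rfl
  have e : algebraMap R (Localization.Away f) (f ^ m * a + f ^ n * b) =
      component f h (s + t) * algebraMap R _ f ^ (n + m) := by
    simp only [map_add, map_mul, map_pow, ← ha, ← hb]
    ring
  have hd : D f ≤ D a ⊔ D b := by
    have h1 : D f ≤ D (f ^ m * a + f ^ n * b) := by
      rw [← isUnit_algebraMap_iff, e]
      exact h'.mul (hfu.pow _)
    exact (h1.trans (D_add_le _ _)).trans (sup_le_sup (D_le_D_of_dvd (Dvd.intro_left _ rfl))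
      (D_le_D_of_dvd (Dvd.intro_left _ rfl)))
  calc D f ≤ D f ⊓ (D a ⊔ D b) := le_inf le_rfl hd
    _ = D (f * a) ⊔ D (f * b) := by rw [inf_sup_left, D_mul, D_mul]
    _ ≤ invSup s ⊔ invSup t := sup_le_sup (D_le_invSup.2 (mul_mem_invSet s h ha))
        (D_le_invSup.2 (mul_mem_invSet t h hb))

theorem map_invSup (φ : R →+* A) {u : ZariskiLattice R} (s : structureSections u) :
    map φ (invSup s) = invSup (sectionMap φ u s) := by
  refine le_antisymm (map_le_iff.2 fun f hf => ?_) (le_of_forall_D fun g hg => ?_)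
  · obtain ⟨h, h'⟩ := D_le_invSup.1 hf
    refine D_le_invSup.2 ⟨D_le_map h, ?_⟩
    rw [component_sectionMap φ s h le_rfl]
    exact h'.map _
  · obtain ⟨h, h'⟩ := D_le_invSup.1 hg
    refine D_le_of_covers ((covers_map φ u).mono h) fun f => ?_
    obtain ⟨n, a, ha⟩ := IsLocalization.Away.surj f.1 (component f.1 f.2 s)
    have h1 : D (g * φ f.1) ≤ D g := D_le_D_of_dvd (Dvd.intro _ rfl)
    have h2 : D (g * φ f.1) ≤ D (φ f.1) := D_le_D_of_dvd (Dvd.intro_left _ rfl)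
    have hfu : IsUnit (algebraMap A (Localization.Away (g * φ f.1)) (φ f.1)) :=
      isUnit_algebraMap_iff.2 h2
    have e := congrArg (awayPull φ h2) ha
    rw [map_mul, map_pow, awayPull_algebraMap, awayPull_algebraMap,
      ← component_sectionMap φ s f.2 h2 (h1.trans h), ← awayRes_component h h1] at e
    have hau : IsUnit (algebraMap A (Localization.Away (g * φ f.1)) (φ a)) := by
      rw [← e]
      exact (h'.map _).mul (hfu.pow _)
    have : D (g * φ f.1) ≤ D (φ (f.1 * a)) := by
      rw [← isUnit_algebraMap_iff, map_mul, map_mul]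
      exact hfu.mul hau
    exact this.trans (D_le_map (D_le_invSup.2 (mul_mem_invSet s f.2 ha)))

theorem invSup_sectionRes {u v : ZariskiLattice R} (h : v ≤ u) (s : structureSections u) :
    invSup (sectionRes h s) = v ⊓ invSup s := by
  refine le_antisymm (le_of_forall_D fun f hf => ?_) (le_of_forall_D fun f hf => ?_)
  · obtain ⟨h1, h2⟩ := D_le_invSup.1 hf
    exact le_inf h1 (D_le_invSup.2 ⟨h1.trans h, h2⟩)
  · obtain ⟨_, h2⟩ := D_le_invSup.1 (hf.trans inf_le_right)
    exact D_le_invSup.2 ⟨hf.trans inf_le_left, h2⟩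

/-! ### The sheaf property -/

theorem covers_iUnion {ι : Type*} [Fintype ι] (u : ι → ZariskiLattice R) :
    Covers (fun f : Σ i, { f : R // D f ≤ u i } => f.2.1) (Finset.univ.sup u) := by
  classical
  have key : ∀ s : Finset ι, (s.sup u).ideal ≤
      (Ideal.span (Set.range fun f : Σ i, { f : R // D f ≤ u i } => f.2.1)).radical := by
    intro s
    induction s using Finset.induction_on with
    | empty =>
      rw [Finset.sup_empty, bot_ideal]
      exact Ideal.radical_mono bot_le
    | insert i s _ ih =>
      rw [Finset.sup_insert, sup_ideal]
      refine Ideal.radical_le_radical_iff.2 (sup_le (fun f hf => ?_) ih)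
      exact Ideal.le_radical (Ideal.subset_span ⟨⟨i, f, D_le_iff.2 hf⟩, rfl⟩)
  exact key _

theorem existsUnique_glue {ι : Type*} [Fintype ι] (u : ι → ZariskiLattice R)
    {x : ZariskiLattice R} (hx : x = Finset.univ.sup u) (hu : ∀ i, u i ≤ x)
    (s : ∀ i, structureSections (u i))
    (hs : ∀ i j, sectionRes (inf_le_left : u i ⊓ u j ≤ u i) (s i) =
      sectionRes (inf_le_right : u i ⊓ u j ≤ u j) (s j)) :
    ∃! t : structureSections x, ∀ i, sectionRes (hu i) t = s i := by
  subst hx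
  have hc := covers_iUnion u
  obtain ⟨t, ht, ht'⟩ := existsUnique_section hc (fun f => f.2.2.trans (hu f.1))
    (fun f => component f.2.1 f.2.2 (s f.1)) (fun f g => by
      have h1 : D (f.2.1 * g.2.1) ≤ D f.2.1 := D_le_D_of_dvd (Dvd.intro _ rfl)
      have h2 : D (f.2.1 * g.2.1) ≤ D g.2.1 := D_le_D_of_dvd (Dvd.intro_left _ rfl)
      have e := congrArg (component (f.2.1 * g.2.1)
        (le_inf (h1.trans f.2.2) (h2.trans g.2.2))) (hs f.1 g.1)
      rw [component_sectionRes, component_sectionRes] at e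
      rw [awayRes_component, awayRes_component]
      exact e)
  refine ⟨t, fun i => section_ext fun f hf => ht ⟨i, f, hf⟩, fun t' h => ht' t' fun f => ?_⟩
  rw [← h f.1, component_sectionRes]

end ZariskiLattice

/-! ### Locally ringed lattices -/

/-- A presheaf of rings `F` on a bounded distributive lattice is a sheaf if, for every finite join
`x = u₁ ⊔ ⋯ ⊔ uₙ`, the ring `F(x)` is the equalizer of
`∏ᵢ F(uᵢ) ⇉ ∏ᵢⱼ F(uᵢ ⊓ uⱼ)`. -/
def IsLatticeSheaf {L : Type u} [DistribLattice L] [BoundedOrder L]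
    (F : Lᵒᵖ ⥤ CommRingCat.{u}) : Prop :=
  ∀ (n : ℕ) (u : Fin n → L) (x : L) (_ : x = Finset.univ.sup u) (hu : ∀ i, u i ≤ x)
    (s : ∀ i, F.obj (op (u i))),
    (∀ i j, F.map (homOfLE (inf_le_left : u i ⊓ u j ≤ u i)).op (s i) =
      F.map (homOfLE (inf_le_right : u i ⊓ u j ≤ u j)).op (s j)) →
    ∃! t : F.obj (op x), ∀ i, F.map (homOfLE (hu i)).op t = s i

/-- `v` is an invertibility supremum of the section `s` over `u`: it is the largest element below
`u` on which `s` becomes invertible. -/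
def IsInvertibilitySup {L : Type u} [Preorder L] (F : Lᵒᵖ ⥤ CommRingCat.{u}) {u : L}
    (s : F.obj (op u)) (v : Set.Iic u) : Prop :=
  ∀ (w : L) (h : w ≤ u), w ≤ v.1 ↔ IsUnit (F.map (homOfLE h).op s)

/-- A locally ringed lattice: a bounded distributive lattice with a sheaf of rings and an
invertibility support. -/
structure LRDL : Type (u + 1) where
  /-- the underlying lattice -/
  L : Type u
  [distribLattice : DistribLattice L]
  [boundedOrder : BoundedOrder L]
  /-- the structure sheaf -/
  O : Lᵒᵖ ⥤ CommRingCat.{u}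
  isSheaf : IsLatticeSheaf O
  /-- the invertibility support -/
  inv : ∀ u : L, O.obj (op u) → Set.Iic u
  isInvertibilitySup : ∀ (u : L) (s : O.obj (op u)), IsInvertibilitySup O s (inv u s)
  isSupport : ∀ u : L, IsSupport (inv u)

namespace LRDL

attribute [instance] LRDL.distribLattice LRDL.boundedOrder

/-- The functor between (opposite) poset categories given by a lattice homomorphism. -/
abbrev pushIndex {L M : Type u} [DistribLattice L] [BoundedOrder L] [DistribLattice M]
    [BoundedOrder M] (f : BoundedLatticeHom L M) : Lᵒᵖ ⥤ Mᵒᵖ :=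
  (show Monotone f from OrderHomClass.mono f).functor.op

/-- A morphism of locally ringed lattices: a lattice homomorphism `π*`, a natural transformation
`π♯ : 𝓞_X ⟹ π_* 𝓞_Y`, compatible with the invertibility supports. -/
structure Hom (X Y : LRDL.{u}) : Type u where
  /-- the lattice homomorphism `π*` -/
  base : BoundedLatticeHom X.L Y.L
  /-- the natural transformation `π♯` -/
  sharp : X.O ⟶ pushIndex base ⋙ Y.O
  map_inv : ∀ (u : X.L) (s : X.O.obj (op u)),
    base (X.inv u s).1 = (Y.inv (base u) (sharp.app (op u) s)).1

theorem Hom.ext' {X Y : LRDL.{u}} {f g : Hom X Y} (hb : ∀ u, f.base u = g.base u)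
    (hs : ∀ (u : X.L) (s : X.O.obj (op u)),
      Y.O.map (homOfLE (hb u).ge).op (f.sharp.app (op u) s) = g.sharp.app (op u) s) : f = g := by
  obtain ⟨fb, fs, hf⟩ := f
  obtain ⟨gb, gs, hg⟩ := g
  obtain rfl : fb = gb := DFunLike.ext _ _ hb
  obtain rfl : fs = gs := by
    ext ⟨u⟩ s
    rw [← hs u s]
    change _ = Y.O.map (𝟙 (op (fb u))) _
    rw [Y.O.map_id]
    rfl
  rfl

theorem Hom.naturality {X Y : LRDL.{u}} (f : Hom X Y) {u v : X.L} (h : v ≤ u)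
    (h' : f.base v ≤ f.base u) (s : X.O.obj (op u)) :
    f.sharp.app (op v) (X.O.map (homOfLE h).op s) =
      Y.O.map (homOfLE h').op (f.sharp.app (op u) s) :=
  NatTrans.naturality_apply f.sharp (homOfLE h).op s

/-- The identity morphism. -/
def Hom.id (X : LRDL.{u}) : Hom X X where
  base := BoundedLatticeHom.id X.L
  sharp := { app := fun u => 𝟙 (X.O.obj u) }
  map_inv _ _ := rfl

/-- Composition of morphisms. -/
def Hom.comp {X Y Z : LRDL.{u}} (f : Hom X Y) (g : Hom Y Z) : Hom X Z where
  base := g.base.comp f.base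
  sharp := f.sharp ≫ Functor.whiskerLeft (pushIndex f.base) g.sharp
  map_inv u s := (congrArg g.base (f.map_inv u s)).trans (g.map_inv _ _)

theorem map_refl (X : LRDL.{u}) {u : X.L} (h : u ≤ u) (s : X.O.obj (op u)) :
    X.O.map (homOfLE h).op s = s := by
  change X.O.map (𝟙 (op u)) s = s
  rw [X.O.map_id]
  rfl

instance : Category.{u} LRDL.{u} where
  Hom := Hom
  id := Hom.id
  comp := Hom.comp
  id_comp _ := Hom.ext' (fun _ => rfl) fun _ _ => map_refl _ _ _
  comp_id _ := Hom.ext' (fun _ => rfl) fun _ _ => map_refl _ _ _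
  assoc _ _ _ := Hom.ext' (fun _ => rfl) fun _ _ => map_refl _ _ _

theorem hom_ext {X Y : LRDL.{u}} {f g : X ⟶ Y} (hb : ∀ u, f.base u = g.base u)
    (hs : ∀ (u : X.L) (s : X.O.obj (op u)),
      Y.O.map (homOfLE (hb u).ge).op (f.sharp.app (op u) s) = g.sharp.app (op u) s) : f = g :=
  Hom.ext' hb hs

end LRDL

/-! ### The spectrum of a ring -/

section Spec

open ZariskiLattice

/-- The structure sheaf on the Zariski lattice. -/
def structureSheaf (R : CommRingCat.{u}) : (ZariskiLattice R)ᵒᵖ ⥤ CommRingCat.{u} where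
  obj u := CommRingCat.of (structureSections u.unop)
  map i := CommRingCat.ofHom (sectionRes i.unop.le)

/-- The spectrum of a ring: the Zariski lattice with its structure sheaf. -/
def LRDL.specObj (R : CommRingCat.{u}) : LRDL.{u} where
  L := ZariskiLattice R
  O := structureSheaf R
  isSheaf _ u _ hx hu s hs := existsUnique_glue u hx hu s hs
  inv u s := ⟨invSup (u := u) s, invSup_le _⟩
  isInvertibilitySup _ s _ h := le_invSup_iff h s
  isSupport u :=
    { map_zero := Subtype.ext (invSup_zero u)
      map_one := Subtype.ext (invSup_one u)
      map_mul := fun s t => Subtype.ext (invSup_mul (u := u) s t)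
      map_add_le := fun s t => invSup_add_le (u := u) s t }

/-- The morphism of spectra induced by a ring homomorphism. -/
noncomputable def LRDL.specMap {R A : CommRingCat.{u}} (φ : R ⟶ A) :
    LRDL.specObj R ⟶ LRDL.specObj A where
  base := ZariskiLattice.map φ.hom
  sharp :=
    { app := fun u => CommRingCat.ofHom (sectionMap φ.hom u.unop)
      naturality := fun u v i => by
        ext s
        exact (sectionRes_sectionMap φ.hom i.unop.le
          (OrderHomClass.mono (ZariskiLattice.map φ.hom) i.unop.le) s).symm }
  map_inv u s := map_invSup φ.hom (u := u) s

/-- The spectrum as a covariant functor from rings to locally ringed lattices. -/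
noncomputable def LRDL.specFunctor : CommRingCat.{u} ⥤ LRDL.{u} where
  obj := LRDL.specObj
  map := LRDL.specMap
  map_id _ := LRDL.hom_ext (fun u => ZariskiLattice.map_id u)
    fun u s => sectionMap_id (u := u) s (ZariskiLattice.map_id u).ge
  map_comp φ ψ := LRDL.hom_ext (fun u => ZariskiLattice.map_comp ψ.hom φ.hom u)
    fun u s => sectionMap_comp ψ.hom φ.hom (u := u) s (ZariskiLattice.map_comp ψ.hom φ.hom u).ge

/-- The functor `Spec : CommRing^op ⥤ LRDL^op`. -/
noncomputable def LRDL.Spec : CommRingCat.{u}ᵒᵖ ⥤ LRDL.{u}ᵒᵖ := LRDL.specFunctor.op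

end Spec

/-! ### Universe lifting -/

section Lift

/-- The homomorphism between universe lifts induced by a ring homomorphism. -/
def uliftRingHom {R A : Type u} [CommRing R] [CommRing A] (φ : R →+* A) :
    ULift.{u + 1} R →+* ULift.{u + 1} A where
  toFun x := ⟨φ x.down⟩
  map_one' := congrArg ULift.up φ.map_one
  map_zero' := congrArg ULift.up φ.map_zero
  map_mul' x y := congrArg ULift.up (φ.map_mul x.down y.down)
  map_add' x y := congrArg ULift.up (φ.map_add x.down y.down)

/-- The homomorphism between universe lifts induced by a lattice homomorphism. -/
def uliftLatticeHom {L M : Type u} [DistribLattice L] [BoundedOrder L] [DistribLattice M]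
    [BoundedOrder M] (f : BoundedLatticeHom L M) :
    BoundedLatticeHom (ULift.{u + 1} L) (ULift.{u + 1} M) where
  toFun u := ⟨f u.down⟩
  map_sup' u v := congrArg ULift.up (map_sup f u.down v.down)
  map_inf' u v := congrArg ULift.up (map_inf f u.down v.down)
  map_top' := congrArg ULift.up (map_top f)
  map_bot' := congrArg ULift.up (map_bot f)

theorem isUnit_ulift_iff {R : Type u} [CommRing R] (x : ULift.{u + 1} R) :
    IsUnit x ↔ IsUnit x.down :=
  (MulEquiv.isUnit_map (ULift.ringEquiv : ULift.{u + 1} R ≃+* R)).symm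

theorem down_finset_sup {L : Type u} [DistribLattice L] [BoundedOrder L] {n : ℕ}
    (u : Fin n → ULift.{u + 1} L) :
    (Finset.univ.sup u).down = Finset.univ.sup fun i => (u i).down :=
  Finset.apply_sup_eq_sup_comp ULift.down (fun _ _ => rfl) rfl

/-- The universe lift of a presheaf of rings on a lattice. -/
def uliftPresheaf {L : Type u} [DistribLattice L] (F : Lᵒᵖ ⥤ CommRingCat.{u}) :
    (ULift.{u + 1} L)ᵒᵖ ⥤ CommRingCat.{u + 1} where
  obj v := CommRingCat.of (ULift.{u + 1} (F.obj (op v.unop.down)))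
  map {v w} i := CommRingCat.ofHom
    (uliftRingHom (F.map (homOfLE (show w.unop.down ≤ v.unop.down from i.unop.le)).op).hom)
  map_id v := by
    ext s
    change F.map (𝟙 (op v.unop.down)) s.down = s.down
    rw [F.map_id]
    rfl
  map_comp {v w x} i j := by
    ext s
    exact F.map_comp_apply (homOfLE (show w.unop.down ≤ v.unop.down from i.unop.le)).op
      (homOfLE (show x.unop.down ≤ w.unop.down from j.unop.le)).op s.down

/-- The universe lift of a locally ringed lattice. -/
def LRDL.liftObj (X : LRDL.{u}) : LRDL.{u + 1} where
  L := ULift.{u + 1} X.L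
  O := uliftPresheaf X.O
  isSheaf n u x hx hu s hs := by
    obtain ⟨t, ht, ht'⟩ := X.isSheaf n (fun i => (u i).down) x.down
      ((congrArg ULift.down hx).trans (down_finset_sup u)) hu (fun i => (s i).down)
      (fun i j => congrArg ULift.down (hs i j))
    exact ⟨⟨t⟩, fun i => congrArg ULift.up (ht i), fun t' h =>
      congrArg ULift.up (ht' t'.down fun i => congrArg ULift.down (h i))⟩
  inv u s := ⟨⟨(X.inv u.down s.down).1⟩, (X.inv u.down s.down).2⟩
  isInvertibilitySup u s w h :=
    (X.isInvertibilitySup u.down s.down w.down h).trans (isUnit_ulift_iff _).symm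
  isSupport u :=
    { map_zero := Subtype.ext (congrArg (fun v => ULift.up v.1) (X.isSupport u.down).map_zero)
      map_one := Subtype.ext (congrArg (fun v => ULift.up v.1) (X.isSupport u.down).map_one)
      map_mul := fun s t => Subtype.ext
        (congrArg (fun v => ULift.up v.1) ((X.isSupport u.down).map_mul s.down t.down))
      map_add_le := fun s t => (X.isSupport u.down).map_add_le s.down t.down }

/-- The universe lift of a morphism of locally ringed lattices. -/
def LRDL.liftMap {X Y : LRDL.{u}} (f : X ⟶ Y) : X.liftObj ⟶ Y.liftObj where
  base := uliftLatticeHom f.base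
  sharp :=
    { app := fun (u : (ULift.{u + 1} X.L)ᵒᵖ) =>
        CommRingCat.ofHom (uliftRingHom (f.sharp.app (op u.unop.down)).hom)
      naturality := fun (u v : (ULift.{u + 1} X.L)ᵒᵖ) i => by
        ext s
        exact congrArg ULift.up (f.naturality (show v.unop.down ≤ u.unop.down from i.unop.le)
          (OrderHomClass.mono f.base (show v.unop.down ≤ u.unop.down from i.unop.le)) s.down) }
  map_inv (u : ULift.{u + 1} X.L) (s : ULift.{u + 1} (X.O.obj (op u.down))) :=
    congrArg ULift.up (f.map_inv u.down s.down)

/-- The functor `lift : LRDL_ℓ^op ⥤ LRDL_{ℓ+1}^op` induced by universe lifting. -/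
def LRDL.lift : LRDL.{u}ᵒᵖ ⥤ LRDL.{u + 1}ᵒᵖ :=
  Functor.op
    { obj := LRDL.liftObj
      map := LRDL.liftMap
      map_id := fun _ => LRDL.hom_ext (fun _ => rfl) fun _ _ => LRDL.map_refl _ _ _
      map_comp := fun {_ _ Z} f g => LRDL.hom_ext (fun _ => rfl) fun u s =>
        (LRDL.map_refl Z.liftObj le_rfl ((LRDL.liftMap (f ≫ g)).sharp.app (op u) s)).trans rfl }

end Lift

/-! ### `ℤ`-functors and compact opens -/

/-- A `ℤ`-functor is a functor from (small) commutative rings to (small) sets. -/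
abbrev ZFunctor : Type (u + 1) := CommRingCat.{u} ⥤ Type u

namespace ZFunctor

open ZariskiLattice

/-- The `ℤ`-functor sending a ring to (the underlying set of) its Zariski lattice. -/
def zariski : ZFunctor.{u} where
  obj R := ZariskiLattice R
  map φ := ↾(ZariskiLattice.map φ.hom)
  map_id _ := ConcreteCategory.hom_ext _ _ fun u => ZariskiLattice.map_id u
  map_comp φ ψ := ConcreteCategory.hom_ext _ _ fun u => ZariskiLattice.map_comp ψ.hom φ.hom u

/-- The affine line: the forgetful functor from rings to sets. -/
abbrev affineLine : ZFunctor.{u} := forget CommRingCat.{u}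

/-- A compact open of `X` is a natural transformation from `X` to the Zariski lattice. -/
def CompOpen (X : ZFunctor.{u}) : Type (u + 1) := X ⟶ zariski

namespace CompOpen

variable {X Y Z : ZFunctor.{u}}

/-- The value of a compact open at a point. -/
def ev (U : CompOpen X) {R : CommRingCat.{u}} (x : X.obj R) : ZariskiLattice R :=
  NatTrans.app U R x

theorem ev_map (U : CompOpen X) {R A : CommRingCat.{u}} (φ : R ⟶ A) (x : X.obj R) :
    U.ev (X.map φ x) = ZariskiLattice.map φ.hom (U.ev x) :=
  NatTrans.naturality_apply (F := X) (G := zariski) U φ x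

theorem ext {U V : CompOpen X} (h : ∀ (R : CommRingCat.{u}) (x : X.obj R), U.ev x = V.ev x) :
    U = V := by
  refine NatTrans.ext (funext fun R => ?_)
  ext x
  exact h R x

/-- Build a compact open from its values. -/
def ofEv (e : ∀ R : CommRingCat.{u}, X.obj R → ZariskiLattice R)
    (he : ∀ (R A : CommRingCat.{u}) (φ : R ⟶ A) (x : X.obj R),
      e A (X.map φ x) = ZariskiLattice.map φ.hom (e R x)) : CompOpen X where
  app R := ↾(e R)
  naturality R A φ := by
    ext x
    exact he R A φ x

instance : PartialOrder (CompOpen X) :=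
  PartialOrder.lift (fun U (R : CommRingCat.{u}) (x : X.obj R) => U.ev x)
    fun _ _ h => ext fun R x => congrFun (congrFun h R) x

theorem le_iff {U V : CompOpen X} :
    U ≤ V ↔ ∀ (R : CommRingCat.{u}) (x : X.obj R), U.ev x ≤ V.ev x := Iff.rfl

/-- The lattice operations on compact opens are defined pointwise. -/
instance : DistribLattice (CompOpen X) where
  sup U V := ofEv (fun _ x => U.ev x ⊔ V.ev x) fun _ _ φ x => by
    rw [ev_map, ev_map, map_sup]
  inf U V := ofEv (fun _ x => U.ev x ⊓ V.ev x) fun _ _ φ x => by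
    rw [ev_map, ev_map, map_inf]
  le_sup_left U V := fun _ _ => le_sup_left (α := ZariskiLattice _)
  le_sup_right U V := fun _ _ => le_sup_right (α := ZariskiLattice _)
  sup_le U V W h h' := fun R x => sup_le (α := ZariskiLattice _) (h R x) (h' R x)
  inf_le_left U V := fun _ _ => inf_le_left (α := ZariskiLattice _)
  inf_le_right U V := fun _ _ => inf_le_right (α := ZariskiLattice _)
  le_inf U V W h h' := fun R x => le_inf (α := ZariskiLattice _) (h R x) (h' R x)
  le_sup_inf U V W := fun _ x => le_sup_inf (x := U.ev x) (y := V.ev x) (z := W.ev x)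

instance : BoundedOrder (CompOpen X) where
  top := ofEv (fun _ _ => ⊤) fun _ _ φ _ => (map_top (ZariskiLattice.map φ.hom)).symm
  le_top _ := fun _ _ => le_top (α := ZariskiLattice _)
  bot := ofEv (fun _ _ => ⊥) fun _ _ φ _ => (map_bot (ZariskiLattice.map φ.hom)).symm
  bot_le _ := fun _ _ => bot_le (α := ZariskiLattice _)

theorem finset_sup_ev {ι : Type*} (s : Finset ι) (U : ι → CompOpen X) {R : CommRingCat.{u}}
    (x : X.obj R) : (s.sup U).ev x = s.sup fun i => (U i).ev x :=
  Finset.apply_sup_eq_sup_comp (fun V : CompOpen X => V.ev x) (fun _ _ => rfl) rfl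

/-- The realization of a compact open `U` of `X`: the subfunctor of points at which `U` is the
top element `D(1)`. -/
def realization (U : CompOpen X) : ZFunctor.{u} where
  obj R := { x : X.obj R // U.ev x = ⊤ }
  map {R A} φ := ↾fun x => ⟨X.map φ x.1, by rw [ev_map, x.2, map_top]⟩
  map_id R := ConcreteCategory.hom_ext _ _ fun x => Subtype.ext (X.map_id_apply R x.1)
  map_comp φ ψ := ConcreteCategory.hom_ext _ _ fun x => Subtype.ext (X.map_comp_apply φ ψ x.1)

/-- The inclusion of realizations for `V ≤ U`. -/
def realizationIncl {U V : CompOpen X} (h : V ≤ U) : V.realization ⟶ U.realization where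
  app R := ↾fun x => ⟨x.1, top_le_iff.1 (x.2.ge.trans (h R x.1))⟩

/-- Pullback of compact opens along a natural transformation. -/
def pullback (α : X ⟶ Y) : BoundedLatticeHom (CompOpen Y) (CompOpen X) where
  toFun U := α ≫ (U : Y ⟶ zariski)
  map_sup' _ _ := rfl
  map_inf' _ _ := rfl
  map_top' := rfl
  map_bot' := rfl

/-- The restriction of `α : X ⟹ Y` to the realizations of `U ∘ α` and `U`. -/
def realizationMap (α : X ⟶ Y) (U : CompOpen Y) :
    (pullback α U).realization ⟶ U.realization where
  app R := ↾fun x => ⟨α.app R x.1, x.2⟩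
  naturality _ _ φ := ConcreteCategory.hom_ext _ _ fun x =>
    Subtype.ext (NatTrans.naturality_apply α φ x.1)

end CompOpen

/-! ### Rings of functions -/

/-- The natural transformations `X ⟹ 𝔸¹`. -/
def Functions (X : ZFunctor.{u}) : Type (u + 1) := X ⟶ affineLine

namespace Functions

variable {X Y Z : ZFunctor.{u}}

/-- The value of a function at a point. -/
def ev (s : Functions X) {R : CommRingCat.{u}} (x : X.obj R) : R := NatTrans.app s R x

theorem ev_map (s : Functions X) {R A : CommRingCat.{u}} (φ : R ⟶ A) (x : X.obj R) :
    s.ev (X.map φ x) = φ.hom (s.ev x) :=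
  NatTrans.naturality_apply (F := X) (G := affineLine) s φ x

theorem ext {s t : Functions X} (h : ∀ (R : CommRingCat.{u}) (x : X.obj R), s.ev x = t.ev x) :
    s = t := by
  refine NatTrans.ext (funext fun R => ?_)
  ext x
  exact h R x

/-- Build a function from its values. -/
def ofEv (e : ∀ R : CommRingCat.{u}, X.obj R → R)
    (he : ∀ (R A : CommRingCat.{u}) (φ : R ⟶ A) (x : X.obj R),
      e A (X.map φ x) = φ.hom (e R x)) : Functions X where
  app R := ↾(e R)
  naturality R A φ := by
    ext x
    exact he R A φ x

variable (X) in
/-- The natural families of ring elements, as a subring of all families. -/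
def naturalFamilies : Subring (∀ R : CommRingCat.{u}, X.obj R → R) where
  carrier := { e | ∀ (R A : CommRingCat.{u}) (φ : R ⟶ A) (x : X.obj R),
    e A (X.map φ x) = φ.hom (e R x) }
  mul_mem' hs ht R A φ x := by simp only [Pi.mul_apply, map_mul, hs R A φ x, ht R A φ x]
  one_mem' R A φ x := by simp only [Pi.one_apply, map_one]
  add_mem' hs ht R A φ x := by simp only [Pi.add_apply, map_add, hs R A φ x, ht R A φ x]
  zero_mem' R A φ x := by simp only [Pi.zero_apply, map_zero]
  neg_mem' hs R A φ x := by simp only [Pi.neg_apply, map_neg, hs R A φ x]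

variable (X) in
/-- Functions are the same as natural families. -/
def equivNaturalFamilies : Functions X ≃ naturalFamilies X where
  toFun s := ⟨fun _ x => s.ev x, fun _ _ φ x => s.ev_map φ x⟩
  invFun e := ofEv e.1 e.2
  left_inv _ := rfl
  right_inv _ := rfl

/-- The ring of functions on a `ℤ`-functor, with the pointwise operations. -/
instance : CommRing (Functions X) := (equivNaturalFamilies X).commRing

/-- Evaluation at a point is a ring homomorphism. -/
def evHom {R : CommRingCat.{u}} (x : X.obj R) : Functions X →+* R where
  toFun s := s.ev x
  map_one' := rfl
  map_zero' := rfl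
  map_mul' _ _ := rfl
  map_add' _ _ := rfl

theorem one_ev {R : CommRingCat.{u}} (x : X.obj R) : (1 : Functions X).ev x = 1 := rfl

theorem mul_ev (s t : Functions X) {R : CommRingCat.{u}} (x : X.obj R) :
    (s * t).ev x = s.ev x * t.ev x := rfl

/-- Precomposition of functions with a natural transformation. -/
def pullback (α : X ⟶ Y) : Functions Y →+* Functions X where
  toFun s := α ≫ (s : Y ⟶ affineLine)
  map_one' := rfl
  map_zero' := rfl
  map_mul' _ _ := rfl
  map_add' _ _ := rfl

theorem isUnit_iff {s : Functions X} :
    IsUnit s ↔ ∀ (R : CommRingCat.{u}) (x : X.obj R), IsUnit (s.ev x) := by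
  refine ⟨fun h R x => h.map (evHom x), fun h => ?_⟩
  choose t ht using fun (R : CommRingCat.{u}) (x : X.obj R) => isUnit_iff_exists_inv.1 (h R x)
  refine isUnit_iff_exists_inv.2 ⟨ofEv t fun R A φ x => ?_, ext fun R x => ht R x⟩
  have e := congrArg φ.hom (ht R x)
  rw [map_mul, map_one, ← ev_map] at e
  exact left_inv_eq_right_inv ((mul_comm _ _).trans (ht A (X.map φ x))) e

end Functions

/-! ### Geometric realization -/

section Realization

variable {X Y Z : ZFunctor.{u}}

/-- The localization map `R ⟶ R_f`. -/
abbrev locMap {R : CommRingCat.{u}} (f : R) : R ⟶ CommRingCat.of (Localization.Away f) :=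
  CommRingCat.ofHom (algebraMap R (Localization.Away f))

theorem ev_locMap (U : CompOpen X) {R : CommRingCat.{u}} (x : X.obj R) {f : R}
    (hf : D f ≤ U.ev x) : U.ev (X.map (locMap f) x) = ⊤ := by
  rw [CompOpen.ev_map, ← top_le_iff, ← D_eq_top_iff.2 (isUnit_algebraMap_iff.2 (le_refl (D f))),
    ← map_D]
  exact OrderHomClass.mono (ZariskiLattice.map _) hf

/-- The restriction of a point `x` of `X` with `D(f) ≤ U(x)` to an `R_f`-valued point of the
realization of `U`. -/
def locPoint (U : CompOpen X) {R : CommRingCat.{u}} (x : X.obj R) {f : R} (hf : D f ≤ U.ev x) :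
    U.realization.obj (CommRingCat.of (Localization.Away f)) :=
  ⟨X.map (locMap f) x, ev_locMap U x hf⟩

theorem map_locPoint (U : CompOpen X) {R : CommRingCat.{u}} (x : X.obj R) {f g : R}
    (hf : D f ≤ U.ev x) (h : D g ≤ D f) :
    U.realization.map (CommRingCat.ofHom (awayRes h)) (locPoint U x hf) =
      locPoint U x (h.trans hf) := by
  refine Subtype.ext ?_
  change X.map _ (X.map _ x) = X.map _ x
  rw [← X.map_comp_apply]
  exact congrArg (fun ψ => X.map ψ x) (CommRingCat.hom_ext (RingHom.ext fun r =>
    awayRes_algebraMap h r))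

theorem map_locPoint' (U : CompOpen X) {R A : CommRingCat.{u}} (φ : R ⟶ A) (x : X.obj R)
    {f : R} {g : A} (hf : D f ≤ U.ev x) (h : D g ≤ D (φ.hom f))
    (hg : D g ≤ U.ev (X.map φ x)) :
    U.realization.map (CommRingCat.ofHom (awayPull φ.hom h)) (locPoint U x hf) =
      locPoint U (X.map φ x) hg := by
  refine Subtype.ext ?_
  change X.map _ (X.map _ x) = X.map _ (X.map _ x)
  rw [← X.map_comp_apply, ← X.map_comp_apply]
  exact congrArg (fun ψ => X.map ψ x) (CommRingCat.hom_ext (RingHom.ext fun r =>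
    awayPull_algebraMap h r))

/-- A function `s` on the realization of `U` and a point `x` of `X` over `R` give a section of the
structure sheaf of `R` over `U(x)`, whose component in `R_f` is the value of `s` at the
restriction of `x` to `R_f`. -/
def pointSection (U : CompOpen X) {R : CommRingCat.{u}} (x : X.obj R) :
    Functions U.realization →+* structureSections (U.ev x) where
  toFun s := ⟨fun f => s.ev (locPoint U x f.2), fun f _ h =>
    (s.ev_map (CommRingCat.ofHom (awayRes h)) (locPoint U x f.2)).symm.trans
      (congrArg (fun y => s.ev y) (map_locPoint U x f.2 h))⟩
  map_one' := rfl
  map_zero' := rfl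
  map_mul' _ _ := rfl
  map_add' _ _ := rfl

theorem component_pointSection (U : CompOpen X) {R : CommRingCat.{u}} (x : X.obj R)
    (s : Functions U.realization) (f : R) (hf : D f ≤ U.ev x) :
    component f hf (pointSection U x s) = s.ev (locPoint U x hf) := rfl

theorem pointSection_map (U : CompOpen X) {R A : CommRingCat.{u}} (φ : R ⟶ A) (x : X.obj R)
    (s : Functions U.realization) (h : U.ev (X.map φ x) ≤ ZariskiLattice.map φ.hom (U.ev x)) :
    sectionRes h (sectionMap φ.hom (U.ev x) (pointSection U x s)) =
      pointSection U (X.map φ x) s := by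
  have e := (U.ev_map φ x).ge
  refine section_ext_of_covers ((covers_map φ.hom (U.ev x)).mono h) (fun f hf => ?_)
    fun f => (D_le_map f.2).trans e
  rw [component_sectionRes, component_sectionMap φ.hom _ f.2 le_rfl, component_pointSection,
    component_pointSection]
  refine (s.ev_map (CommRingCat.ofHom (awayPull φ.hom le_rfl)) (locPoint U x f.2)).symm.trans ?_
  exact congrArg (fun y => s.ev y) (map_locPoint' U φ x f.2 le_rfl hf)

theorem pointSection_incl {U V : CompOpen X} (h : V ≤ U) (s : Functions U.realization)
    {R : CommRingCat.{u}} (x : X.obj R) :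
    pointSection V x (Functions.pullback (CompOpen.realizationIncl h) s) =
      sectionRes (h R x) (pointSection U x s) := rfl

/-- The structure sheaf of the geometric realization: it sends a compact open `U` to the ring of
functions on its realization. -/
def realizationSheaf (X : ZFunctor.{u}) : (CompOpen X)ᵒᵖ ⥤ CommRingCat.{u + 1} where
  obj U := CommRingCat.of (Functions U.unop.realization)
  map i := CommRingCat.ofHom (Functions.pullback (CompOpen.realizationIncl i.unop.le))

/-- The invertibility supremum of a function `s` on a compact open `U`: at a point `x` over `R`, it
is the join of the `D(f) ≤ U(x)` such that the value of `s` at the restriction of `x` to `R_f` is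
invertible. -/
def invOpen {U : CompOpen X} (s : Functions U.realization) : CompOpen X :=
  CompOpen.ofEv (fun _ x => invSup (pointSection U x s)) fun R A φ x => by
    have h := U.ev_map φ x
    rw [map_invSup, ← pointSection_map U φ x s h.le, invSup_sectionRes, inf_eq_right, h]
    exact invSup_le _

theorem invOpen_ev {U : CompOpen X} (s : Functions U.realization) {R : CommRingCat.{u}}
    (x : X.obj R) : (invOpen s).ev x = invSup (pointSection U x s) := rfl

theorem invOpen_le {U : CompOpen X} (s : Functions U.realization) : invOpen s ≤ U :=
  fun _ _ => invSup_le _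

theorem algebraMap_ev {U : CompOpen X} (s : Functions U.realization) {R : CommRingCat.{u}}
    (x : U.realization.obj R) {f : R} (hf : D f ≤ U.ev x.1) :
    algebraMap R (Localization.Away f) (s.ev x) = s.ev (locPoint U x.1 hf) :=
  (s.ev_map (locMap f) x).symm

theorem le_invOpen_iff {U W : CompOpen X} (h : W ≤ U) (s : Functions U.realization) :
    W ≤ invOpen s ↔ IsUnit (Functions.pullback (CompOpen.realizationIncl h) s) := by
  constructor
  · intro hW
    refine Functions.isUnit_iff.2 fun R x => ?_
    have h1 : D (1 : R) ≤ W.ev x.1 := by rw [x.2]; exact le_top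
    obtain ⟨h2, h3⟩ := D_le_invSup.1 (h1.trans (hW R x.1))
    rw [component_pointSection] at h3
    have h4 := algebraMap_ev (Functions.pullback (CompOpen.realizationIncl h) s) x h1
    have h5 : IsUnit (algebraMap R (Localization.Away (1 : R))
        ((Functions.pullback (CompOpen.realizationIncl h) s).ev x)) := by
      rw [h4]
      exact h3
    exact (MulEquiv.isUnit_map
      (IsLocalization.atUnit R (Localization.Away (1 : R)) 1 isUnit_one)).1 h5
  · intro hs R x
    refine (le_invSup_iff (h R x) (pointSection U x s)).2 ?_
    rw [← pointSection_incl h]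
    exact hs.map (pointSection W x)

theorem realizationSheaf_isSheaf (X : ZFunctor.{u}) : IsLatticeSheaf (realizationSheaf X) := by
  intro n U W hW hU s hs
  let s' : ∀ i, Functions (U i).realization := s
  have hev : ∀ {R : CommRingCat.{u}} (x : X.obj R),
      W.ev x = Finset.univ.sup fun i => (U i).ev x := fun x => by
    rw [hW, CompOpen.finset_sup_ev]
  have hglue : ∀ (R : CommRingCat.{u}) (x : X.obj R), ∃! t : structureSections (W.ev x),
      ∀ i, sectionRes (hU i R x) t = pointSection (U i) x (s' i) := fun R x =>
    existsUnique_glue (fun i => (U i).ev x) (hev x) (fun i => hU i R x)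
      (fun i => pointSection (U i) x (s' i))
      (fun i j => congrArg (fun t : Functions (U i ⊓ U j).realization =>
        pointSection (U i ⊓ U j) x t) (hs i j))
  have hr : ∀ (R : CommRingCat.{u}) (x : W.realization.obj R), ∃ r : R,
      ∀ i, sectionRes le_top (ofRing r) = pointSection (U i) x.1 (s' i) := fun R x => by
    obtain ⟨t, ht, _⟩ := hglue R x.1
    obtain ⟨r, hr⟩ := ofRing_bijective.2 (sectionRes x.2.ge t)
    refine ⟨r, fun i => ?_⟩
    rw [hr, ← ht i]
    rfl
  have huniq : ∀ (R : CommRingCat.{u}) (x : W.realization.obj R) (r r' : R),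
      (∀ i, sectionRes le_top (ofRing r) = pointSection (U i) x.1 (s' i)) →
      (∀ i, sectionRes le_top (ofRing r') = pointSection (U i) x.1 (s' i)) → r = r' := by
    intro R x r r' h h'
    refine ofRing_bijective.1 ?_
    have e := (hglue R x.1).unique (y₁ := sectionRes le_top (ofRing r))
      (y₂ := sectionRes le_top (ofRing r')) h h'
    exact congrArg (sectionRes x.2.ge) e
  choose r hr using hr
  have hnat : ∀ (R A : CommRingCat.{u}) (φ : R ⟶ A) (x : W.realization.obj R),
      r A (W.realization.map φ x) = φ.hom (r R x) := by
    intro R A φ x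
    refine huniq A _ _ _ (hr A _) fun i => ?_
    have e := congrArg (fun t => sectionRes ((U i).ev_map φ x.1).le
      (sectionMap φ.hom ((U i).ev x.1) t)) (hr R x i)
    dsimp only at e
    rw [pointSection_map] at e
    refine Eq.trans ?_ e
    refine section_ext_of_covers ((covers_map φ.hom ((U i).ev x.1)).mono ((U i).ev_map φ x.1).le)
      (fun f hf => ?_) fun f => (D_le_map f.2).trans ((U i).ev_map φ x.1).ge
    refine Eq.trans ?_ (component_sectionMap φ.hom
      (sectionRes (le_top : (U i).ev x.1 ≤ ⊤) (ofRing (r R x))) f.2 le_rfl _).symm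
    exact (awayPull_algebraMap (φ := φ.hom) (le_refl (D (φ.hom f.1))) (r R x)).symm
  have hres : ∀ (t : Functions W.realization), (∀ i,
      Functions.pullback (CompOpen.realizationIncl (hU i)) t = s' i) ↔
      ∀ (R : CommRingCat.{u}) (x : W.realization.obj R) (i : Fin n),
        sectionRes le_top (ofRing (t.ev x)) = pointSection (U i) x.1 (s' i) := by
    intro t
    constructor
    · intro h R x i
      rw [← h i]
      exact section_ext fun f hf => algebraMap_ev t x (hf.trans (hU i R x.1))
    · intro h i
      refine Functions.ext fun R x => algebraMap_one_bijective.1 ?_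
      have h1 : D (1 : R) ≤ (U i).ev x.1 := by rw [x.2]; exact le_top
      rw [algebraMap_ev (s' i) x h1]
      exact congrArg (component 1 h1)
        (h R ((CompOpen.realizationIncl (hU i)).app R x) i)
  refine ⟨Functions.ofEv r hnat, (hres _).2 hr, fun t ht => Functions.ext fun R x => ?_⟩
  exact huniq R x _ _ ((hres t).1 ht R x) (hr R x)

/-- The geometric realization of a `ℤ`-functor. -/
def realizationObj (X : ZFunctor.{u}) : LRDL.{u + 1} where
  L := CompOpen X
  O := realizationSheaf X
  isSheaf := realizationSheaf_isSheaf X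
  inv U s := ⟨invOpen (U := U) s, invOpen_le (U := U) s⟩
  isInvertibilitySup U s _ h := le_invOpen_iff (U := U) h s
  isSupport U :=
    { map_zero := Subtype.ext (CompOpen.ext fun R x => by
        change invSup (pointSection U x 0) = ⊥
        rw [map_zero, invSup_zero])
      map_one := Subtype.ext (CompOpen.ext fun R x => by
        change invSup (pointSection U x 1) = U.ev x
        rw [map_one, invSup_one])
      map_mul := fun s t => Subtype.ext (CompOpen.ext fun R x => by
        change invSup (pointSection U x s * pointSection U x t) =
          invSup (pointSection U x s) ⊓ invSup (pointSection U x t)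
        rw [invSup_mul])
      map_add_le := fun s t => fun R x => by
        exact invSup_add_le (pointSection U x s) (pointSection U x t) }

/-- The morphism of locally ringed lattices induced by a natural transformation, given by
precomposition. -/
def realizationHom (α : X ⟶ Y) : realizationObj Y ⟶ realizationObj X where
  base := CompOpen.pullback α
  sharp :=
    { app := fun (U : (CompOpen Y)ᵒᵖ) =>
        CommRingCat.ofHom (Functions.pullback (CompOpen.realizationMap α U.unop)) }
  map_inv (U : CompOpen Y) (s : Functions U.realization) := CompOpen.ext fun R x => by
    change invSup (pointSection U (α.app R x) s) = invSup (pointSection (CompOpen.pullback α U) x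
      (Functions.pullback (CompOpen.realizationMap α U) s))
    congr 1
    refine section_ext fun f hf => congrArg (fun y => s.ev y) (Subtype.ext ?_)
    exact (NatTrans.naturality_apply α (locMap f) x).symm

/-- The geometric realization functor `|_| : ℤ-Fun_ℓ ⥤ LRDL_{ℓ+1}^op`. -/
def geometricRealization : ZFunctor.{u} ⥤ LRDL.{u + 1}ᵒᵖ where
  obj X := op (realizationObj X)
  map α := (realizationHom α).op
  map_id _ := congrArg Quiver.Hom.op (LRDL.hom_ext (fun _ => rfl) fun _ _ => rfl)
  map_comp _ _ := congrArg Quiver.Hom.op (LRDL.hom_ext (fun _ => rfl) fun _ _ => rfl)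

end Realization

end ZFunctor

/-- The functor of points `h : LRDL_ℓ^op ⥤ ℤ-Fun_ℓ`, sending `X` to
`R ↦ Hom_{LRDL^op}(Spec R, X)`; on morphisms it is given by postcomposition. -/
noncomputable def LRDL.functorOfPoints : LRDL.{u}ᵒᵖ ⥤ ZFunctor.{u} where
  obj X :=
    { obj := fun R => LRDL.Spec.obj (op R) ⟶ X
      map := fun φ => ↾fun π => LRDL.Spec.map φ.op ≫ π
      map_id := fun R => by
        ext π
        exact (congrArg (· ≫ π) (LRDL.Spec.map_id (op R))).trans (Category.id_comp π)
      map_comp := fun φ ψ => by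
        ext π
        exact (congrArg (· ≫ π) (LRDL.Spec.map_comp ψ.op φ.op)).trans (Category.assoc _ _ π) }
  map ρ :=
    { app := fun R => ↾fun π => π ≫ ρ
      naturality := fun R A φ => by
        ext π
        exact (Category.assoc _ _ ρ) }
  map_id X := by
    ext R π
    exact Category.comp_id π
  map_comp ρ ρ' := by
    ext R π
    exact (Category.assoc π ρ ρ').symm

/-- For functors `l : 𝓒 ⥤ 𝓓`, `F : 𝓑 ⥤ 𝓓` and `G : 𝓒 ⥤ 𝓑`, an `l`-relative coadjunction
`F ⊣_l G` is a family of bijections `Hom_𝓓(F b, l c) ≃ Hom_𝓑(b, G c)` natural in `b` and `c`. -/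
structure RelativeCoadjunction {𝓑 𝓒 𝓓 : Type*} [Category 𝓑] [Category 𝓒] [Category 𝓓]
    (l : 𝓒 ⥤ 𝓓) (F : 𝓑 ⥤ 𝓓) (G : 𝓒 ⥤ 𝓑) where
  homEquiv : ∀ (b : 𝓑) (c : 𝓒), (F.obj b ⟶ l.obj c) ≃ (b ⟶ G.obj c)
  naturality_left : ∀ {b b' : 𝓑} (c : 𝓒) (β : b' ⟶ b) (π : F.obj b ⟶ l.obj c),
    homEquiv b' c (F.map β ≫ π) = β ≫ homEquiv b c π
  naturality_right : ∀ (b : 𝓑) {c c' : 𝓒} (γ : c ⟶ c') (π : F.obj b ⟶ l.obj c),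
    homEquiv b c' (π ≫ l.map γ) = homEquiv b c π ≫ G.map γ

namespace ZFunctor

open ZariskiLattice

variable {X X' : ZFunctor.{u}} {Y : LRDL.{u}}

/-! The bijection is an exchange of variables. Read in `LRDL` rather than its opposite, a morphism
`|X| → lift Y` consists of a lattice map from `Y` to the compact opens of `X` and of ring maps from
the sections of `Y` over `u` to the functions on the realization of the compact open assigned to
`u`. All of this can be evaluated at a point `x` of `X` over `R`. A compact open `U` has a value
`U(x)` in the Zariski lattice of `R`. A function on the realization of `U` gives, through
`pointSection`, a section of the structure sheaf of `R` over `U(x)`. With `u` varying and `x` fixed,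
the result is a morphism from `Y` to the spectrum of `R`, that is, an `R`-point of `h_Y`
(`pointHom`). Naturality in `R` is `pointHom_map`. Invertibility supports cause no trouble, because
the support on `|X|` is computed point by point from `invSup`.

Conversely, let `α : X ⟹ h_Y`. Fixing `u` and letting `x` vary, the preimages of `u` under the
morphisms `homAt α x` form a compact open `openAt α u`. If `x` lies in its realization, a section
over `u` pulls back to a global section on the spectrum of `R`, and global sections are the elements
of `R` (`ofRing_bijective`). This element is the value at `x` of the function attached to the
section (`valueAt`, `functionAt`).

The substance lies in the comparison of sections over `U(x)` with values at points where `U` is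
everything. One direction takes a point `x` with `U(x)` arbitrary and builds a section out of values
at the restrictions of `x` to the localizations `R_f`, for `D(f) ≤ U(x)`. The other direction keeps
only the values where `U(x)` is the top element. Nothing is lost: by naturality of `α` along `R →
R_f`, the component in `R_f` of the pulled-back section is the value at the restricted point. This
is `pointSection_functionAt`; it yields one of the two inverse laws and also the compatibility with
supports. The other inverse law is the same comparison for `f = 1`, where `R → R_1` is bijective. -/

/-! ### Evaluating a morphism at the points of a `ℤ`-functor -/

/-- In each `R_f` both components evaluate `s` at an `R_f`-point of the realization of `U`, and
naturality of `β` along `R → R_f` makes the two points equal. This becomes naturality of the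
bijection in `X`. -/
theorem pointSection_pullback (β : X' ⟶ X) (U : CompOpen X) (s : Functions U.realization)
    {R : CommRingCat.{u}} (x : X'.obj R) :
    pointSection (CompOpen.pullback β U) x (Functions.pullback (CompOpen.realizationMap β U) s) =
      pointSection U (β.app R x) s := by
  refine section_ext fun f hf => congrArg (fun y => s.ev y) (Subtype.ext ?_)
  exact NatTrans.naturality_apply β (locMap f) x

/-- A morphism from the universe lift of `Y` to the geometric realization of `X` and a point `x`
of `X` over `R` give a morphism from `Y` to the spectrum of `R`. -/
def pointHom (π : Y.liftObj ⟶ realizationObj X) {R : CommRingCat.{u}} (x : X.obj R) :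
    Y ⟶ LRDL.specObj R where
  base :=
    { toFun := fun u => CompOpen.ev (π.base ⟨u⟩) x
      map_sup' := fun u v =>
        congrArg (fun W : CompOpen X => W.ev x) (π.base.map_sup' (ULift.up u) (ULift.up v))
      map_inf' := fun u v =>
        congrArg (fun W : CompOpen X => W.ev x) (π.base.map_inf' (ULift.up u) (ULift.up v))
      map_top' := congrArg (fun W : CompOpen X => W.ev x) (map_top π.base)
      map_bot' := congrArg (fun W : CompOpen X => W.ev x) (map_bot π.base) }
  sharp :=
    { app := fun u => CommRingCat.ofHom
        ((pointSection (π.base ⟨u.unop⟩) x).comp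
          ((π.sharp.app (op ⟨u.unop⟩)).hom.comp
            (ULift.ringEquiv.symm : Y.O.obj u ≃+* ULift.{u + 1} (Y.O.obj u)).toRingHom))
      naturality := fun u v i => by
        ext s
        -- Passing from functions to sections at `x` commutes with restriction by definition
        -- (`pointSection_incl`), so only the naturality of `π.sharp` has to be supplied.
        exact congrArg (fun t => pointSection (π.base ⟨v.unop⟩) x t)
          (LRDL.Hom.naturality π (u := ULift.up u.unop) (v := ULift.up v.unop) i.unop.le
            (OrderHomClass.mono π.base (show ULift.up.{u + 1} v.unop ≤ ULift.up u.unop from i.unop.le))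
            (ULift.up s)) }
  -- At `x` the support of the realization is, by definition, `invSup` of the section at `x`; hence
  -- the condition on `π` only has to be evaluated there.
  map_inv u s := congrArg (fun W : CompOpen X => W.ev x) (π.map_inv ⟨u⟩ ⟨s⟩)

/-- On lattices this is naturality of a compact open; on sections it is `pointSection_map`. The
equation is proved backwards because `LRDL.hom_ext` restricts the left-hand section, and in
`pointSection_map` the restricted section is the one pulled back along `φ`. -/
theorem pointHom_map (π : Y.liftObj ⟶ realizationObj X) {R A : CommRingCat.{u}} (φ : R ⟶ A)
    (x : X.obj R) : pointHom π (X.map φ x) = pointHom π x ≫ LRDL.specMap φ :=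
  (LRDL.hom_ext (fun u => (CompOpen.ev_map (π.base ⟨u⟩) φ x).symm) fun u s =>
    pointSection_map (π.base ⟨u⟩) φ x (π.sharp.app (op ⟨u⟩) ⟨s⟩)
      (CompOpen.ev_map (π.base ⟨u⟩) φ x).le).symm

/-- The natural transformation to the functor of points given by a morphism out of the geometric
realization. -/
def toPoints (π : Y.liftObj ⟶ realizationObj X) : X ⟶ LRDL.functorOfPoints.obj (op Y) where
  app _ := ↾fun x => (pointHom π x).op
  naturality _ _ φ := by
    ext x
    exact congrArg Quiver.Hom.op (pointHom_map π φ x)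

/-! ### Compact opens and sections attached to a transformation into `h_Y` -/

/-- The morphism from `Y` to the spectrum of `R` which a natural transformation to the functor of
points of `Y` assigns to a point over `R`. -/
def homAt (α : X ⟶ LRDL.functorOfPoints.obj (op Y)) {R : CommRingCat.{u}} (x : X.obj R) :
    Y ⟶ LRDL.specObj R :=
  Quiver.Hom.unop (α.app R x)

theorem homAt_map (α : X ⟶ LRDL.functorOfPoints.obj (op Y)) {R A : CommRingCat.{u}} (φ : R ⟶ A)
    (x : X.obj R) : homAt α (X.map φ x) = homAt α x ≫ LRDL.specMap φ :=
  congrArg Quiver.Hom.unop (NatTrans.naturality_apply α φ x)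

theorem toPoints_ext {α β : X ⟶ LRDL.functorOfPoints.obj (op Y)}
    (h : ∀ (R : CommRingCat.{u}) (x : X.obj R), homAt α x = homAt β x) : α = β := by
  ext R x
  exact congrArg Quiver.Hom.op (h R x)

/-- The compact open of `X` whose value at a point is the preimage of an element of `Y`. -/
def openAt (α : X ⟶ LRDL.functorOfPoints.obj (op Y)) (u : Y.L) : CompOpen X :=
  CompOpen.ofEv (fun _ x => (homAt α x).base u) fun _ _ φ x => by rw [homAt_map]; rfl

/-- The section of the structure sheaf of `R` which is the pullback of a section of `Y` along the
morphism assigned to a point over `R`. -/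
def sectionAt (α : X ⟶ LRDL.functorOfPoints.obj (op Y)) (u : Y.L) {R : CommRingCat.{u}}
    (x : X.obj R) : Y.O.obj (op u) →+* structureSections ((openAt α u).ev x) :=
  ((homAt α x).sharp.app (op u)).hom

theorem sectionAt_res (α : X ⟶ LRDL.functorOfPoints.obj (op Y)) {u v : Y.L} (h : v ≤ u)
    {R : CommRingCat.{u}} (x : X.obj R) (h' : (openAt α v).ev x ≤ (openAt α u).ev x)
    (s : Y.O.obj (op u)) :
    sectionAt α v x (Y.O.map (homOfLE h).op s) = sectionRes h' (sectionAt α u x s) :=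
  (homAt α x).naturality h h' s

/-- The section-level content of the naturality of `α`. The two sections live over elements that are
equal only propositionally, and a restriction takes the place of a cast. -/
theorem sectionAt_map (α : X ⟶ LRDL.functorOfPoints.obj (op Y)) (u : Y.L) {R A : CommRingCat.{u}}
    (φ : R ⟶ A) (x : X.obj R)
    (h : (openAt α u).ev (X.map φ x) ≤ ZariskiLattice.map φ.hom ((openAt α u).ev x))
    (s : Y.O.obj (op u)) :
    sectionAt α u (X.map φ x) s =
      sectionRes h (sectionMap φ.hom _ (sectionAt α u x s)) := by
  -- Stated for two arbitrary equal morphisms so that the equality can be substituted; what remains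
  -- is restriction from an element to itself, which is the identity by definition.
  have key : ∀ (f g : Y ⟶ LRDL.specObj A) (e : f = g) (h : f.base u ≤ g.base u),
      (f.sharp.app (op u) s : structureSections (f.base u)) =
        sectionRes h (g.sharp.app (op u) s : structureSections (g.base u)) := by
    rintro f _ rfl h
    rfl
  exact key _ _ (homAt_map α φ x) h

/-! ### From sections of `Y` to functions on realizations -/

/-- Global sections of the structure sheaf of `R` are elements of `R`. -/
noncomputable def ringEquivTop (R : Type u) [CommRing R] :
    R ≃+* structureSections (⊤ : ZariskiLattice R) :=
  RingEquiv.ofBijective ofRing ofRing_bijective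

/-- The value of a section `s` over `u` at a point at which `u` pulls back to the top element. -/
noncomputable def valueAt (α : X ⟶ LRDL.functorOfPoints.obj (op Y)) (u : Y.L)
    {R : CommRingCat.{u}} (x : (openAt α u).realization.obj R) : Y.O.obj (op u) →+* R :=
  -- Since `x` is in the realization, the section already lives over everything; restriction along
  -- `x.2.ge` only moves it to the literal `⊤`.
  (ringEquivTop R).symm.toRingHom.comp ((sectionRes x.2.ge).comp (sectionAt α u x.1))

theorem ofRing_valueAt (α : X ⟶ LRDL.functorOfPoints.obj (op Y)) (u : Y.L)
    {R : CommRingCat.{u}} (x : (openAt α u).realization.obj R) (s : Y.O.obj (op u)) :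
    ofRing (valueAt α u x s) = sectionRes x.2.ge (sectionAt α u x.1 s) :=
  (ringEquivTop R).apply_symm_apply _

/-- Global sections are detected in `R_1`, because `R → R_1` is injective. Through this criterion
later arguments compute with one component of a section instead of with the inverse of
`ringEquivTop`. -/
theorem eq_valueAt_iff (α : X ⟶ LRDL.functorOfPoints.obj (op Y)) (u : Y.L)
    {R : CommRingCat.{u}} (x : (openAt α u).realization.obj R) (s : Y.O.obj (op u)) (r : R)
    (h : D (1 : R) ≤ (openAt α u).ev x.1) :
    r = valueAt α u x s ↔
      algebraMap R (Localization.Away (1 : R)) r = component 1 h (sectionAt α u x.1 s) := by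
  rw [← algebraMap_one_bijective.1.eq_iff]
  have e := congrArg (component 1 le_top) (ofRing_valueAt α u x s)
  rw [component_ofRing, component_sectionRes] at e
  rw [e]

/-- The comparison takes place in `A_1`: by `sectionAt_map`, the component there is the image of the
component in `R_1` under the map `R_1 → A_1` induced by `φ`. -/
theorem valueAt_map (α : X ⟶ LRDL.functorOfPoints.obj (op Y)) (u : Y.L) {R A : CommRingCat.{u}}
    (φ : R ⟶ A) (x : (openAt α u).realization.obj R) (s : Y.O.obj (op u)) :
    valueAt α u ((openAt α u).realization.map φ x) s = φ.hom (valueAt α u x s) := by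
  have h1 : D (1 : R) ≤ (openAt α u).ev x.1 := by rw [x.2]; exact le_top
  have h2 : D (1 : A) ≤ (openAt α u).ev (X.map φ x.1) := by
    rw [CompOpen.ev_map, x.2, map_top]; exact le_top
  -- Needed because `awayPull` is indexed by `φ 1`, which is not syntactically `1`.
  have h3 : D (1 : A) ≤ D (φ.hom 1) := by rw [map_one]
  refine Eq.symm ((eq_valueAt_iff α u ((openAt α u).realization.map φ x) s _ h2).2 ?_)
  have e := (eq_valueAt_iff α u x s _ h1).1 rfl
  refine (awayPull_algebraMap h3 _).symm.trans ?_
  rw [e]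
  refine Eq.trans ?_ (congrArg (component 1 h2)
    (sectionAt_map α u φ x.1 ((openAt α u).ev_map φ x.1).le s)).symm
  exact (component_sectionMap φ.hom _ h1 h3 _).symm

/-- The function on the realization of `openAt α u` given by a section over `u`. -/
noncomputable def functionAt (α : X ⟶ LRDL.functorOfPoints.obj (op Y)) (u : Y.L) :
    Y.O.obj (op u) →+* Functions (openAt α u).realization where
  toFun s := Functions.ofEv (fun _ x => valueAt α u x s) fun _ _ φ x => valueAt_map α u φ x s
  map_one' := Functions.ext fun _ x => map_one (valueAt α u x)
  map_zero' := Functions.ext fun _ x => map_zero (valueAt α u x)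
  map_mul' s t := Functions.ext fun _ x => map_mul (valueAt α u x) s t
  map_add' s t := Functions.ext fun _ x => map_add (valueAt α u x) s t

/-- The component of the left side in `R_f` is the value at the restriction of `x` to `R_f`. By
`sectionAt_map` along `R → R_f`, that value is read off from the pullback of the section at `x` to
the spectrum of `R_f`. Pulling back sends the component in `R_f` to its canonical image in
`(R_f)_1`, so nothing changes under the identification of `R_f` with `(R_f)_1`. -/
theorem pointSection_functionAt (α : X ⟶ LRDL.functorOfPoints.obj (op Y)) (u : Y.L)
    {R : CommRingCat.{u}} (x : X.obj R) (s : Y.O.obj (op u)) :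
    pointSection (openAt α u) x (functionAt α u s) = sectionAt α u x s := by
  refine section_ext fun f hf => ?_
  rw [component_pointSection]
  refine Eq.symm ?_
  have h2 : D (1 : Localization.Away f) ≤ (openAt α u).ev (X.map (locMap f) x) := by
    rw [ev_locMap _ x hf]; exact le_top
  -- The image of `f` is a unit in `R_f`, so its basic open is everything and the induced map `R_f →
  -- (R_f)_1` exists.
  have h3 : D (1 : Localization.Away f) ≤ D ((locMap f).hom f) :=
    le_top.trans (D_eq_top_iff.2 (isUnit_algebraMap_iff.2 (le_refl (D f)))).ge
  refine (eq_valueAt_iff α u (locPoint _ x hf) s _ h2).2 ?_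
  refine Eq.trans ?_ (congrArg (component 1 h2)
    (sectionAt_map α u (locMap f) x ((openAt α u).ev_map (locMap f) x).le s)).symm
  refine Eq.trans ?_ (component_sectionMap (locMap f).hom (sectionAt α u x s) hf h3 _).symm
  -- This induced map is the localization map, since two homomorphisms out of `R_f` that agree on
  -- `R` coincide.
  exact away_hom_ext (α := algebraMap (Localization.Away f) (Localization.Away 1))
    (β := awayPull (locMap f).hom h3) (fun r => (awayPull_algebraMap h3 r).symm) _

theorem openAt_mono (α : X ⟶ LRDL.functorOfPoints.obj (op Y)) : Monotone (openAt α) :=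
  fun _ _ h _ x => OrderHomClass.mono (homAt α x).base h

/-- Both values at `x` are determined by a component in `R_1`, and restricting a section does not
alter its components. -/
theorem functionAt_res (α : X ⟶ LRDL.functorOfPoints.obj (op Y)) {u v : Y.L} (h : v ≤ u)
    (s : Y.O.obj (op u)) :
    functionAt α v (Y.O.map (homOfLE h).op s) =
      Functions.pullback (CompOpen.realizationIncl (openAt_mono α h)) (functionAt α u s) := by
  refine Functions.ext fun R x => ?_
  have h' := openAt_mono α h R x.1
  have h1 : D (1 : R) ≤ (openAt α v).ev x.1 := by rw [x.2]; exact le_top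
  -- A point at which the smaller compact open is `⊤` is also a point of the realization of the
  -- larger one.
  have e := (eq_valueAt_iff α u ⟨x.1, top_le_iff.1 (x.2.ge.trans h')⟩ s _ (h1.trans h')).1 rfl
  refine Eq.symm ((eq_valueAt_iff α v x _ _ h1).2 (e.trans ?_))
  exact congrArg (component 1 h1) (sectionAt_res α h x.1 h' s).symm

/-! ### The inverse construction and the bijection -/

/-- The morphism out of the geometric realization of `X` given by a natural transformation to the
functor of points. -/
noncomputable def ofPoints (α : X ⟶ LRDL.functorOfPoints.obj (op Y)) :
    Y.liftObj ⟶ realizationObj X where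
  base :=
    { toFun := fun u => openAt α u.down
      map_sup' := fun u v => CompOpen.ext fun _ x => (homAt α x).base.map_sup' u.down v.down
      map_inf' := fun u v => CompOpen.ext fun _ x => (homAt α x).base.map_inf' u.down v.down
      map_top' := CompOpen.ext fun _ x => map_top (homAt α x).base
      map_bot' := CompOpen.ext fun _ x => map_bot (homAt α x).base }
  sharp :=
    { app := fun u => CommRingCat.ofHom ((functionAt α u.unop.down).comp
        (ULift.ringEquiv : ULift.{u + 1} (Y.O.obj (op u.unop.down)) ≃+* _).toRingHom)
      naturality := fun u v i => by
        ext s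
        exact functionAt_res α (show v.unop.down ≤ u.unop.down from i.unop.le) s.down }
  map_inv u s := CompOpen.ext fun R x => by
    -- Each `homAt α x` already respects supports; `pointSection_functionAt` identifies its section
    -- with the one from which the support on the realization is computed.
    refine ((homAt α x).map_inv u.down s.down).trans ?_
    exact congrArg invSup (pointSection_functionAt α u.down x s.down).symm

/-- Morphisms from the universe lift of `Y` to the geometric realization of `X` are the same as
natural transformations from `X` to the functor of points of `Y`. -/
noncomputable def pointsEquiv (X : ZFunctor.{u}) (Y : LRDL.{u}) :
    (Y.liftObj ⟶ realizationObj X) ≃ (X ⟶ LRDL.functorOfPoints.obj (op Y)) where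
  toFun := toPoints
  invFun := ofPoints
  -- Compact opens return by definition. For functions, the recovered value at `x` is characterized
  -- in `R_1` by the value of the original function at the restriction of `x` to `R_1`, and
  -- `algebraMap_ev` identifies that with the image of its value at `x`.
  left_inv π := LRDL.hom_ext (fun _ => rfl) fun u s => by
    refine Functions.ext fun R x => Eq.symm ?_
    have h1 : D (1 : R) ≤ CompOpen.ev (π.base u) x.1 := by rw [x.2]; exact le_top
    exact (eq_valueAt_iff (toPoints π) u.down x s.down _ h1).2
      (algebraMap_ev (U := π.base u) (π.sharp.app (op u) s) x h1)
  right_inv α := toPoints_ext fun R x => LRDL.hom_ext (fun _ => rfl) fun u s =>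
    pointSection_functionAt α u x s

end ZFunctor

/-! ### Naturality in both variables -/

theorem mainTheorem5 :
    Nonempty (RelativeCoadjunction LRDL.lift.{u} ZFunctor.geometricRealization.{u}
      LRDL.functorOfPoints.{u}) := by
  refine ⟨{
    homEquiv := fun X Y => Quiver.Hom.opEquiv.symm.trans (ZFunctor.pointsEquiv X Y.unop)
    naturality_left := fun {X X'} Y β π => ?_
    naturality_right := fun X {Y Y'} γ π => ?_ }⟩
  · refine ZFunctor.toPoints_ext fun R x => LRDL.hom_ext (fun _ => rfl) fun u s => ?_
    exact ZFunctor.pointSection_pullback β (π.unop.base ⟨u⟩) (π.unop.sharp.app (op ⟨u⟩) ⟨s⟩) x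
  -- In `LRDL` the map `γ` acts on the `Y` side before anything is evaluated at `x`, so both sides
  -- are the same composite by definition.
  · exact ZFunctor.toPoints_ext fun R x => LRDL.hom_ext (fun _ => rfl) fun u s => rfl
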